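/- Let $d\ge 1$ and let $x\sim y$ mean $\|x-y\|_1=1$ for $x,y\in\mathbb{Z}^d$. Let $\Omega=\{0,1\}^{\mathbb{Z}^d}$ with the product topology and product $\sigma$-field, and for $p\in(0,1)$ let $\mathbb{P}$ be the product of Bernoulli laws of parameter $p$ (with expectation $\mathbb{E}$). For $\omega\in\Omega$ let $C_x=C_x(\omega)$ be the cardinality of the cluster of $x$, i.e. of the set of sites joined to $x$ by a nearest neighbour path all of whose vertices $v$ (end points included) satisfy $\omega_v=1$ (so $C_x=0$ if $\omega_x=0$). Let $p_c=p_c(d)$ be the supremum of the parameters for which $\mathbb{P}$-a.s. all clusters are finite, assume $0<p<p_c$, and let $\xi=\xi(p)=-\lim_{n\to\infty}\frac1n\ln\mathbb{P}(C_0\ge n)$ (the limit is known to exist, with $\xi>0$; it may be read as $\xi=\liminf_{n\to\infty}-\frac1n\ln\mathbb{P}(C_0\ge n)$). Let $\ell\in\mathbb{R}^d$ be a unit vector and $\lambda,\beta\ge 0$. For $\omega\in\Omega$ let $P_\omega$ be the law of the continuous time Markov chain $Y=(Y_t)_{t\ge0}$ on $\mathbb{Z}^d$, with right-continuous paths, started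 at $0$, with generator $$Lf(x)=K\sum_{e\sim0}e^{\lambda\,\ell\cdot e-\beta C_x}\,[f(x+e)-f(x)],\qquad K=\Big(\sum_{e\sim0}e^{\lambda\,\ell\cdot e}\Big)^{-1}.$$ Let $(T^x\omega)_y=\omega_{x+y}$, and let $\hat\omega_t=T^{Y_t}\omega$ be the environment seen from the walker. If $\beta<\xi$, then $\mathbb{E}[e^{\beta C_0}]<\infty$, and almost surely under the annealed law $P=\mathbb{P}\times P_\omega$ (that is, for $\mathbb{P}$-almost every $\omega$, $P_\omega$-almost surely) the empirical distribution $$\frac1t\int_0^t\delta_{\hat\omega_s}\,ds$$ converges weakly, as $t\to\infty$, to the probability measure $\mathbb{P}^0$ on $\Omega$ defined by $d\mathbb{P}^0=\dfrac{e^{\beta C_0}}{\mathbb{E}[e^{\beta C_0}]}\,d\mathbb{P}$. -/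

import Mathlib

open MeasureTheory ProbabilityTheory Filter Topology
open scoped NNReal ENNReal BoundedContinuousFunction

/-! ### The lattice and its site percolation -/

/-- The lattice `ℤ^d`. -/
abbrev ZLattice (d : ℕ) : Type := Fin d → ℤ

/-- The `ℓ¹`-norm on `ℤ^d`. -/
def l1Norm {d : ℕ} (x : ZLattice d) : ℤ := ∑ k, |x k|

/-- The graph of nearest neighbours on `ℤ^d`: `x ∼ y` when `‖x - y‖₁ = 1`. -/
def latticeGraph (d : ℕ) : SimpleGraph (ZLattice d) where
  Adj x y := l1Norm (x - y) = 1
  symm := ⟨fun x y h => by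
    have e : y - x = -(x - y) := by abel
    simpa [e, l1Norm, abs_sub_comm] using h⟩
  loopless := ⟨fun x h => by simp [l1Norm] at h⟩

/-- The finite set of the nearest neighbours `e ∼ 0` of the origin. -/
noncomputable def steps (d : ℕ) : Finset (ZLattice d) :=
  (Finset.Icc (-1 : ZLattice d) 1).filter fun e => l1Norm e = 1

theorem mem_steps {d : ℕ} (e : ZLattice d) : e ∈ steps d ↔ (latticeGraph d).Adj e 0 := by
  have key : l1Norm e = 1 → e ∈ Finset.Icc (-1 : ZLattice d) 1 := by
    intro h
    have hk : ∀ k, |e k| ≤ 1 := fun k => by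
      rw [← h]
      exact Finset.single_le_sum (f := fun k => |e k|) (fun i _ => abs_nonneg _)
        (Finset.mem_univ k)
    rw [Finset.mem_Icc]
    exact ⟨fun k => (abs_le.1 (hk k)).1, fun k => (abs_le.1 (hk k)).2⟩
  simp only [steps, Finset.mem_filter, latticeGraph, sub_zero]
  exact ⟨fun h => h.2, fun h => ⟨key h, h⟩⟩

/-- Environments `ω ∈ {0,1}^{ℤ^d}`; the site `x` is open when `ω x = true`.  The `σ`-field and the
topology are the product ones. -/
abbrev Env (d : ℕ) : Type := ZLattice d → Bool

/-- The space shift: `(T^x ω)_y = ω_{x + y}`. -/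
def shift {d : ℕ} (x : ZLattice d) (ω : Env d) : Env d := fun y => ω (x + y)

/-- The i.i.d. Bernoulli site percolation measure `ℬ(p)^{⊗ ℤ^d}`. -/
noncomputable def percolation (d : ℕ) (p : unitInterval) : Measure (Env d) :=
  Measure.infinitePi fun _ : ZLattice d => bernoulliMeasure true false p

/-- The cluster of `x`: the sites joined to `x` by a nearest neighbour path all of whose vertices
(end points included) are open.  It contains `x` if `x` is open, and is empty if `x` is closed. -/
def cluster {d : ℕ} (ω : Env d) (x : ZLattice d) : Set (ZLattice d) :=
  {y | ∃ w : (latticeGraph d).Walk x y, ∀ v ∈ w.support, ω v = true}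

/-- The cardinality `C_x ∈ ℕ ∪ {∞}` of the cluster of `x`. -/
noncomputable def clusterSize {d : ℕ} (ω : Env d) (x : ZLattice d) : ℕ∞ := (cluster ω x).encard

/-- `C_x` as a real number.  (Below `p_c` all clusters are a.s. finite, so that the value `0` given
here to an infinite cluster is immaterial.) -/
noncomputable def clusterCard {d : ℕ} (ω : Env d) (x : ZLattice d) : ℝ :=
  ((clusterSize ω x).toNat : ℝ)

/-- The critical parameter `p_c(d)`: the supremum of the parameters for which almost surely all the
clusters are finite. -/
noncomputable def criticalParameter (d : ℕ) : ℝ :=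
  sSup {r : ℝ | ∃ p : unitInterval, (p : ℝ) = r ∧
    ∀ᵐ ω ∂(percolation d p), ∀ x, (cluster ω x).Finite}

/-- The exponential decay rate `ξ(p) = - lim_n (1/n) ln ℙ(C_0 ≥ n)` of the cluster size.  It is
written with a lower limit so that it makes sense before the limit is known to exist; see
`decayRate_eq_of_tendsto`. -/
noncomputable def decayRate (d : ℕ) (p : unitInterval) : ℝ :=
  liminf (fun n : ℕ =>
    -((1 / (n : ℝ)) * Real.log ((percolation d p).real {ω | (n : ℕ∞) ≤ clusterSize ω 0}))) atTop

theorem decayRate_eq_of_tendsto (d : ℕ) (p : unitInterval) (ξ : ℝ)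
    (h : Tendsto (fun n : ℕ => (1 / (n : ℝ)) *
      Real.log ((percolation d p).real {ω | (n : ℕ∞) ≤ clusterSize ω 0})) atTop (𝓝 (-ξ))) :
    decayRate d p = ξ := by
  have := h.neg.liminf_eq
  rwa [neg_neg] at this

/-! ### Continuous time Markov chains -/

/-- The successive jump times `0 = S_0 < S_1 < S_2 < …` of a path, `S_{n+1}` being the infimum of
the `t > S_n` with `y t ≠ y S_n` (`∞` if there is none). -/
noncomputable def jumpTime {V : Type*} (y : ℝ≥0 → V) : ℕ → ℝ≥0∞
  | 0 => 0
  | n + 1 => ⨅ (t : ℝ≥0) (_ : jumpTime y n < (t : ℝ≥0∞) ∧ y t ≠ y (jumpTime y n).toNNReal),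
      (t : ℝ≥0∞)

/-- The skeleton of a path, `X_n = y S_n` (relevant only when `S_n < ∞`). -/
noncomputable def skeleton {V : Type*} (y : ℝ≥0 → V) (n : ℕ) : V := y (jumpTime y n).toNNReal

/-- The coefficient `q(x, y) = (L 1_{y})(x)` of the operator `L` on functions on `V`. -/
noncomputable def qMatrix {V : Type*} (L : (V → ℝ) → V → ℝ) (x y : V) : ℝ :=
  L (Set.indicator {y} 1) x

/-- `Y` is, under the probability measure `P`, a continuous time Markov chain with right-continuous
paths on the discrete space `V`, started at `v₀`, with generator `L`: with `q x = - q(x, x)`, the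
skeleton is the Markov chain with transition probabilities `q(x, y) / q x` (`y ≠ x`), and, given the
skeleton, the holding times are independent and exponential with rates `q (X_0), q (X_1), …`.
(For bounded rates such a process does not explode, and its law is determined.) -/
structure IsMarkovChainWithGenerator {V Ω' : Type*} [MeasurableSpace V] [MeasurableSpace Ω']
    (L : (V → ℝ) → V → ℝ) (v₀ : V) (Y : ℝ≥0 → Ω' → V) (P : Measure Ω') : Prop where
  isProbabilityMeasure : IsProbabilityMeasure P
  measurable : ∀ t, Measurable (Y t)
  right_continuous : ∀ a t, ∀ᶠ s in 𝓝[>] t, Y s a = Y t a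
  start : ∀ᵐ a ∂P, Y 0 a = v₀
  law : ∀ (n : ℕ) (x : ℕ → V) (u : ℕ → ℝ≥0), x 0 = v₀ → (∀ i < n, x (i + 1) ≠ x i) →
    P.real {a | jumpTime (Y · a) n < ⊤ ∧
        (∀ i ≤ n, skeleton (Y · a) i = x i) ∧
        (∀ i < n, (u i : ℝ≥0∞) < jumpTime (Y · a) (i + 1) - jumpTime (Y · a) i)} =
      ∏ i ∈ Finset.range n, qMatrix L (x i) (x (i + 1)) / -qMatrix L (x i) (x i) *
        Real.exp (qMatrix L (x i) (x i) * u i)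

/-! ### The walk and the environment seen from the walker -/

/-- The Euclidean product `ℓ · e`. -/
noncomputable def dot {d : ℕ} (l : EuclideanSpace ℝ (Fin d)) (e : ZLattice d) : ℝ :=
  ∑ k, l k * (e k : ℝ)

/-- The generator
`L f x = K ∑_{e ∼ 0} exp (λ ℓ · e - β C_x) (f (x + e) - f x)`, `K = (∑_{e ∼ 0} exp (λ ℓ · e))⁻¹`. -/
noncomputable def walkGenerator {d : ℕ} (l : EuclideanSpace ℝ (Fin d)) (lam β : ℝ) (ω : Env d)
    (f : ZLattice d → ℝ) (x : ZLattice d) : ℝ :=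
  (∑ e ∈ steps d, Real.exp (lam * dot l e))⁻¹ *
    ∑ e ∈ steps d, Real.exp (lam * dot l e - β * clusterCard ω x) * (f (x + e) - f x)

/-- The empirical distribution `(1/t) ∫_0^t δ_{T^{y_s} ω} ds` of the environment seen from the
walker with path `y`. -/
noncomputable def empiricalMeasure {d : ℕ} (ω : Env d) (y : ℝ≥0 → ZLattice d) (t : ℝ≥0) :
    Measure (Env d) :=
  (t : ℝ≥0∞)⁻¹ • ((volume : Measure ℝ).restrict (Set.Icc 0 (t : ℝ))).bind
    fun s => Measure.dirac (shift (y s.toNNReal) ω)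

/-- The measure `ℙ⁰`, with `dℙ⁰ = e^{β C_0} / 𝔼[e^{β C_0}] dℙ`. -/
noncomputable def limitMeasure (d : ℕ) (p : unitInterval) (β : ℝ) : Measure (Env d) :=
  (percolation d p).withDensity fun ω => ENNReal.ofReal
    (Real.exp (β * clusterCard ω 0) / ∫ ω', Real.exp (β * clusterCard ω' 0) ∂(percolation d p))

/-- Weak convergence, as `t → ∞`, of probability measures `μ t` (`t > 0`) to a probability measure
`ν`: convergence of the integrals of all bounded continuous functions. -/
def ConvergesWeakly {E : Type*} [TopologicalSpace E] [MeasurableSpace E]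
    (μ : ℝ≥0 → Measure E) (ν : Measure E) : Prop :=
  (∀ t, 0 < t → IsProbabilityMeasure (μ t)) ∧ IsProbabilityMeasure ν ∧
    ∀ f : E →ᵇ ℝ, Tendsto (fun t => ∫ a, f a ∂(μ t)) atTop (𝓝 (∫ a, f a ∂ν))

/-! The factor `e^{-βC_x}` slows the walk at `x` by the same amount in every direction. Hence the
jump chain is a random walk with i.i.d. steps whose law does not involve the environment, and each
holding time becomes a standard exponential once multiplied by the rate `e^{-βC_x}`. The pairs
(step, normalized holding time) thus form an i.i.d. sequence `η` with the same law for every `ω`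
(`IsMarkovChainWithGenerator.map_drivingSequence`); all the dependence on `ω` sits in the time
change.

Sampling `ω` and `η` independently, the environment at the jump times is an orbit of the skew
product `(ω, η) ↦ (shift (η 0).1 ω, η (· + 1))`. It preserves the product measure because every
shift preserves `percolation`. It is ergodic (`ergodic_skewShift`): the fibre measure of an
invariant set is a bounded harmonic function, so it is invariant under almost every step, hence
constant by ergodicity of a single lattice shift (`ergodic_shift`); the fibres are then independent
of every cylinder in `η`, which forces measure 0 or 1.

Birkhoff's theorem, proved here by the maximal inequality, is applied to `e^{βC_0} f(ω) (η 0).2`,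
whose orbit sums are the integrals of `f` along the path up to the jump times. It is integrable
because `β < ξ` gives the cluster size a sufficiently thin tail (`integrable_exp_clusterCard`).
Dividing by the case `f = 1` passes from jumps to real time (`tendsto_div_of_tendsto_jump`) and
creates the normalization of the limit measure. Finally `Env d` is compact and metrizable, so a
countable dense family of test functions suffices and a single null set is discarded. -/

/-! ### The pointwise ergodic theorem -/

section Birkhoff

variable {α : Type*} {T : α → α} {f : α → ℝ}

/-- The running maximum `max_{0 ≤ k ≤ n} ∑_{i < k} f (T^i x)` of the Birkhoff sums. -/
noncomputable def birkhoffMax (T : α → α) (f : α → ℝ) : ℕ → α → ℝ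
  | 0, _ => 0
  | n + 1, x => max 0 (f x + birkhoffMax T f n (T x))

theorem birkhoffMax_nonneg (n : ℕ) (x : α) : 0 ≤ birkhoffMax T f n x := by
  cases n with
  | zero => exact le_rfl
  | succ n => exact le_max_left _ _

theorem birkhoffMax_le_succ (n : ℕ) (x : α) : birkhoffMax T f n x ≤ birkhoffMax T f (n + 1) x := by
  induction n generalizing x with
  | zero => exact birkhoffMax_nonneg 1 x
  | succ n ih => exact max_le_max le_rfl (by linarith [ih (T x)])

theorem birkhoffSum_le_birkhoffMax (n : ℕ) (x : α) :
    birkhoffSum T f n x ≤ birkhoffMax T f n x := by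
  induction n generalizing x with
  | zero => simp [birkhoffMax]
  | succ n ih =>
    rw [birkhoffSum_succ']
    exact le_max_of_le_right (by linarith [ih (T x)])

variable [MeasurableSpace α] {μ : Measure α}

theorem measurable_birkhoffMax (hT : Measurable T) (hf : Measurable f) (n : ℕ) :
    Measurable (birkhoffMax T f n) := by
  induction n with
  | zero => exact measurable_const
  | succ n ih => exact measurable_const.max (hf.add (ih.comp hT))

theorem integrable_birkhoffMax (hT : MeasurePreserving T μ μ) (hf : Integrable f μ) (n : ℕ) :
    Integrable (birkhoffMax T f n) μ := by
  induction n with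
  | zero => exact integrable_zero _ _ _
  | succ n ih =>
    exact (integrable_zero α ℝ μ).sup (hf.add (hT.integrable_comp_of_integrable ih))

/-- The maximal ergodic inequality. -/
theorem setIntegral_birkhoffMax_pos_nonneg (hT : MeasurePreserving T μ μ) (hfm : Measurable f)
    (hf : Integrable f μ) (n : ℕ) : 0 ≤ ∫ x in {x | 0 < birkhoffMax T f n x}, f x ∂μ := by
  have hm := measurable_birkhoffMax hT.measurable hfm n
  have hA : MeasurableSet {x | 0 < birkhoffMax T f n x} := measurableSet_lt measurable_const hm
  have hi := integrable_birkhoffMax hT hf n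
  have hiT : Integrable (fun x => birkhoffMax T f n (T x)) μ := hT.integrable_comp_of_integrable hi
  have h1 : ∫ x in {x | 0 < birkhoffMax T f n x}, birkhoffMax T f n x ∂μ
      = ∫ x, birkhoffMax T f n x ∂μ := by
    apply setIntegral_eq_integral_of_forall_compl_eq_zero
    intro x hx
    exact le_antisymm (not_lt.1 hx) (birkhoffMax_nonneg n x)
  have h2 : ∫ x in {x | 0 < birkhoffMax T f n x}, birkhoffMax T f n (T x) ∂μ
      ≤ ∫ x, birkhoffMax T f n x ∂μ := by
    calc _ ≤ ∫ x, birkhoffMax T f n (T x) ∂μ :=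
          setIntegral_le_integral hiT (ae_of_all _ fun x => birkhoffMax_nonneg n (T x))
      _ = ∫ x, birkhoffMax T f n x ∂(μ.map T) :=
          (integral_map hT.aemeasurable hm.aestronglyMeasurable).symm
      _ = _ := by rw [hT.map_eq]
  -- Garsia's argument: on the set `A` where the maximum `M n` is positive, `M n ≤ f + M n ∘ T`.
  -- With `h1` and `h2`, `∫ M n ≤ ∫_A f + ∫_A M n ∘ T ≤ ∫_A f + ∫ M n`.
  have h3 : ∫ x in {x | 0 < birkhoffMax T f n x}, birkhoffMax T f n x ∂μ
      ≤ ∫ x in {x | 0 < birkhoffMax T f n x}, (f x + birkhoffMax T f n (T x)) ∂μ := by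
    apply setIntegral_mono_on hi.integrableOn (hf.add hiT).integrableOn hA
    intro x hx
    cases n with
    | zero => exact absurd (show (0 : ℝ) < 0 from hx) (lt_irrefl _)
    | succ n =>
      have hx' : 0 < max 0 (f x + birkhoffMax T f n (T x)) := hx
      have : birkhoffMax T f (n + 1) x = f x + birkhoffMax T f n (T x) :=
        max_eq_right (by
          by_contra h
          rw [max_eq_left (not_le.1 h).le] at hx'
          exact lt_irrefl _ hx')
      rw [this]
      have h4 := birkhoffMax_le_succ (T := T) (f := f) n (T x)
      change f x + _ ≤ f x + _
      linarith
  rw [integral_add hf.integrableOn hiT.integrableOn] at h3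
  linarith

/-- The sets in the maximal inequality increase with `n` and, under the hypothesis, exhaust the
space up to a null set. -/
theorem integral_nonneg_of_exists_birkhoffSum_pos (hT : MeasurePreserving T μ μ)
    (hfm : Measurable f) (hf : Integrable f μ)
    (h : ∀ᵐ x ∂μ, ∃ n, 0 < birkhoffSum T f n x) : 0 ≤ ∫ x, f x ∂μ := by
  have hmono : Monotone fun n => {x | 0 < birkhoffMax T f n x} :=
    monotone_nat_of_le_succ fun n x hx => lt_of_lt_of_le hx (birkhoffMax_le_succ n x)
  have hlim := tendsto_setIntegral_of_monotone (f := f) (μ := μ)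
    (fun n => measurableSet_lt measurable_const (measurable_birkhoffMax hT.measurable hfm n))
    hmono hf.integrableOn
  have hU : (⋃ n, {x | 0 < birkhoffMax T f n x}) =ᵐ[μ] Set.univ := by
    rw [eventuallyEq_univ]
    filter_upwards [h] with x ⟨n, hn⟩
    exact Set.mem_iUnion.2 ⟨n, lt_of_lt_of_le hn (birkhoffSum_le_birkhoffMax n x)⟩
  rw [setIntegral_congr_set hU, setIntegral_univ] at hlim
  exact ge_of_tendsto' hlim fun n => setIntegral_birkhoffMax_pos_nonneg hT hfm hf n

theorem measurable_birkhoffSum (hT : Measurable T) (hf : Measurable f) (n : ℕ) :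
    Measurable (birkhoffSum T f n) :=
  Finset.measurable_sum _ fun i _ => hf.comp (hT.iterate i)

/-- The set of points with bounded sums is invariant, hence null or conull. If it were null, almost
every orbit would have a positive sum, and the maximal inequality would contradict the negative
mean. -/
theorem ae_bddAbove_birkhoffSum (hT : Ergodic T μ) (hfm : Measurable f) (hf : Integrable f μ)
    (hneg : ∫ x, f x ∂μ < 0) : ∀ᵐ x ∂μ, ∃ c : ℕ, ∀ n, birkhoffSum T f n x ≤ c := by
  have hB : MeasurableSet {x | ∃ c : ℕ, ∀ n, birkhoffSum T f n x ≤ c} := by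
    rw [Set.ofPred_exists]
    refine MeasurableSet.iUnion fun c => ?_
    rw [Set.ofPred_forall]
    exact MeasurableSet.iInter fun n =>
      measurableSet_le (measurable_birkhoffSum hT.measurable hfm n) measurable_const
  have hinv : T ⁻¹' {x | ∃ c : ℕ, ∀ n, birkhoffSum T f n x ≤ c}
      = {x | ∃ c : ℕ, ∀ n, birkhoffSum T f n x ≤ c} := by
    ext x
    constructor
    · rintro ⟨c, hc⟩
      obtain ⟨k, hk⟩ := exists_nat_ge (|f x| + c)
      refine ⟨k, fun n => ?_⟩
      cases n with
      | zero => simp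
      | succ n =>
        rw [birkhoffSum_succ']
        linarith [hc n, le_abs_self (f x)]
    · rintro ⟨c, hc⟩
      obtain ⟨k, hk⟩ := exists_nat_ge (|f x| + c)
      refine ⟨k, fun n => ?_⟩
      have := hc (n + 1)
      rw [birkhoffSum_succ'] at this
      linarith [neg_abs_le (f x)]
  rcases hT.toPreErgodic.measure_self_or_compl_eq_zero hB hinv with h | h
  · exfalso
    have hae : ∀ᵐ x ∂μ, x ∉ {x | ∃ c : ℕ, ∀ n, birkhoffSum T f n x ≤ c} :=
      measure_eq_zero_iff_ae_notMem.1 h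
    refine hneg.not_ge
      (integral_nonneg_of_exists_birkhoffSum_pos hT.toMeasurePreserving hfm hf ?_)
    filter_upwards [hae] with x hx
    by_contra! hn
    exact hx ⟨0, by simpa using hn⟩
  · exact h

/-- Subtracting slightly more than the mean makes the mean negative, so the centred sums are bounded
above and disappear after division by `n`. The excesses `1 / (k + 1)` keep the null sets countable
in number. -/
theorem ae_eventually_birkhoffSum_le [IsProbabilityMeasure μ] (hT : Ergodic T μ)
    (hfm : Measurable f) (hf : Integrable f μ) :
    ∀ᵐ x ∂μ, ∀ ε > 0, ∀ᶠ n : ℕ in atTop, birkhoffSum T f n x / n ≤ ∫ x, f x ∂μ + ε := by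
  have key : ∀ k : ℕ, ∀ᵐ x ∂μ, ∃ c : ℕ, ∀ n,
      birkhoffSum T (fun y => f y - (∫ x, f x ∂μ + 1 / ((k : ℝ) + 1))) n x ≤ c := by
    intro k
    refine ae_bddAbove_birkhoffSum hT (hfm.sub_const _) (hf.sub (integrable_const _)) ?_
    rw [integral_sub hf (integrable_const _)]
    have : (0 : ℝ) < 1 / ((k : ℝ) + 1) := by positivity
    simp only [integral_const, probReal_univ, smul_eq_mul, one_mul]
    linarith
  filter_upwards [ae_all_iff.2 key] with x hx ε hε
  obtain ⟨k, hk⟩ := exists_nat_one_div_lt (half_pos hε)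
  obtain ⟨c, hc⟩ := hx k
  obtain ⟨N, hN⟩ := exists_nat_gt (c / (ε / 2))
  filter_upwards [eventually_ge_atTop (max N 1)] with n hn
  have hn0 : (0 : ℝ) < n := by
    exact_mod_cast lt_of_lt_of_le one_pos ((le_max_right N 1).trans hn)
  have hNn : (N : ℝ) ≤ n := by exact_mod_cast (le_max_left N 1).trans hn
  have h1 := hc n
  simp only [birkhoffSum, Finset.sum_sub_distrib, Finset.sum_const, Finset.card_range,
    nsmul_eq_mul] at h1
  rw [div_le_iff₀ hn0]
  simp only [birkhoffSum]
  have h2 : c < n * (ε / 2) := by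
    rw [div_lt_iff₀ (half_pos hε)] at hN
    nlinarith
  nlinarith

/-- Birkhoff's pointwise ergodic theorem, for an ergodic transformation. -/
theorem tendsto_birkhoffSum_div [IsProbabilityMeasure μ] (hT : Ergodic T μ)
    (hfm : Measurable f) (hf : Integrable f μ) :
    ∀ᵐ x ∂μ, Tendsto (fun n : ℕ => birkhoffSum T f n x / n) atTop (𝓝 (∫ x, f x ∂μ)) := by
  filter_upwards [ae_eventually_birkhoffSum_le hT hfm hf,
    ae_eventually_birkhoffSum_le hT hfm.neg hf.neg] with x h1 h2
  rw [Metric.tendsto_nhds]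
  intro ε hε
  filter_upwards [h1 (ε / 2) (half_pos hε), h2 (ε / 2) (half_pos hε)] with n hn1 hn2
  have e : birkhoffSum T (-f) n x = - birkhoffSum T f n x := by simp [birkhoffSum]
  have e2 : ∫ x, (-f) x ∂μ = - ∫ x, f x ∂μ := integral_neg f
  rw [e, e2, neg_div] at hn2
  rw [Real.dist_eq, abs_lt]
  constructor <;> linarith

end Birkhoff

/-! ### Ergodicity of the Bernoulli shift -/

section Shift

variable {d : ℕ}

instance (p : unitInterval) : IsProbabilityMeasure (percolation d p) := by
  unfold percolation; infer_instance

theorem measurable_shift (x : ZLattice d) : Measurable (shift x : Env d → Env d) :=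
  measurable_pi_lambda _ fun y => measurable_pi_apply (x + y)

@[simp] theorem shift_zero (ω : Env d) : shift 0 ω = ω := by
  funext y; simp [shift]

theorem shift_shift (x y : ZLattice d) (ω : Env d) : shift y (shift x ω) = shift (x + y) ω := by
  funext z; simp [shift, add_assoc]

theorem shift_iterate (x : ZLattice d) (n : ℕ) : (shift x : Env d → Env d)^[n] = shift (n • x) := by
  induction n with
  | zero => funext ω; simp
  | succ n ih =>
    funext ω
    rw [Function.iterate_succ_apply', ih, shift_shift, succ_nsmul]

/-- The preimage of a square cylinder under a shift. -/
theorem preimage_shift_pi (x : ZLattice d) (s : Finset (ZLattice d)) (t : ZLattice d → Set Bool) :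
    (shift x : Env d → Env d) ⁻¹' (s : Set (ZLattice d)).pi t
      = (↑(s.image (x + ·)) : Set (ZLattice d)).pi fun y => t (y - x) := by
  ext ω
  simp only [Set.mem_preimage, Set.mem_pi, Finset.coe_image, Set.forall_mem_image,
    add_sub_cancel_left]
  rfl

theorem percolation_pi (p : unitInterval) (s : Finset (ZLattice d)) (t : ZLattice d → Set Bool) :
    percolation d p ((s : Set (ZLattice d)).pi t)
      = ∏ y ∈ s, bernoulliMeasure true false p (t y) :=
  Measure.infinitePi_pi _ fun _ _ => MeasurableSet.of_discrete

theorem measurePreserving_shift (p : unitInterval) (x : ZLattice d) :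
    MeasurePreserving (shift x) (percolation d p) (percolation d p) where
  measurable := measurable_shift x
  map_eq := by
    refine Measure.eq_infinitePi _ fun s t ht => ?_
    rw [Measure.map_apply (measurable_shift x)
      (MeasurableSet.pi s.countable_toSet fun i _ => ht i), preimage_shift_pi, percolation_pi,
      Finset.prod_image fun a _ b _ h => add_left_cancel h]
    simp

theorem percolation_inter_pi (p : unitInterval) {s s' : Finset (ZLattice d)} (h : Disjoint s s')
    (t t' : ZLattice d → Set Bool) :
    percolation d p ((s : Set (ZLattice d)).pi t ∩ (s' : Set (ZLattice d)).pi t')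
      = percolation d p ((s : Set (ZLattice d)).pi t)
        * percolation d p ((s' : Set (ZLattice d)).pi t') := by
  have e : (s : Set (ZLattice d)).pi t ∩ (s' : Set (ZLattice d)).pi t'
      = (↑(s ∪ s') : Set (ZLattice d)).pi (s.piecewise t t') := by
    rw [Finset.coe_union, Set.union_pi]
    congr 1
    · exact Set.pi_congr rfl fun i hi => (Finset.piecewise_eq_of_mem _ _ _ hi).symm
    · exact Set.pi_congr rfl fun i hi =>
        (Finset.piecewise_eq_of_notMem _ _ _ (Finset.disjoint_right.1 h hi)).symm
  rw [e, percolation_pi, percolation_pi, percolation_pi, Finset.prod_union h]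
  congr 1
  · exact Finset.prod_congr rfl fun i hi => by rw [Finset.piecewise_eq_of_mem _ _ _ hi]
  · exact Finset.prod_congr rfl fun i hi => by
      rw [Finset.piecewise_eq_of_notMem _ _ _ (Finset.disjoint_right.1 h hi)]

/-- The π-system of square cylinders. -/
abbrev envCylinders (d : ℕ) : Set (Set (Env d)) :=
  squareCylinders fun _ : ZLattice d => {s : Set Bool | MeasurableSet s}

theorem isPiSystem_envCylinders : IsPiSystem (envCylinders d) :=
  isPiSystem_squareCylinders (fun _ => MeasurableSpace.isPiSystem_measurableSet) fun _ => by simp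

theorem measurableSet_of_mem_envCylinders {B : Set (Env d)} (hB : B ∈ envCylinders d) :
    MeasurableSet B := by
  obtain ⟨s, t, -, rfl⟩ := hB
  exact MeasurableSet.pi s.countable_toSet fun _ _ => MeasurableSet.of_discrete

/-- The multiples of `x` are distinct, so only finitely many of them lie in the finite set of
differences `b - a`. -/
theorem eventually_disjoint_image_nsmul_add {x : ZLattice d} (hx : x ≠ 0)
    (s s' : Finset (ZLattice d)) :
    ∀ᶠ n : ℕ in atTop, Disjoint (s.image (n • x + ·)) s' := by
  have hinj : Function.Injective fun n : ℕ => n • x := fun a b h => by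
    obtain ⟨k, hk⟩ := Function.ne_iff.1 hx
    have := congrFun h k
    have hk' : x k ≠ 0 := hk
    simpa [hk'] using this
  have h : ∀ a ∈ s, ∀ b ∈ s', ∀ᶠ n : ℕ in atTop, n • x ≠ b - a := fun a _ b _ => by
    have := hinj.tendsto_cofinite.eventually (eventually_cofinite_ne (b - a))
    rwa [Nat.cofinite_eq_atTop] at this
  have h' := (eventually_all_finset s).2 fun a ha => (eventually_all_finset s').2 (h a ha)
  filter_upwards [h'] with n hn
  rw [Finset.disjoint_left]
  intro c hc hc'
  obtain ⟨a, ha, rfl⟩ := Finset.mem_image.1 hc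
  exact hn a ha _ hc' (by abel)

/-- Mixing of the Bernoulli shift, for an arbitrary event and a cylinder event. -/
theorem tendsto_percolation_shift_inter (p : unitInterval) {x : ZLattice d} (hx : x ≠ 0)
    {B : Set (Env d)} (hB : B ∈ envCylinders d) {A : Set (Env d)} (hA : MeasurableSet A) :
    Tendsto (fun n : ℕ => (percolation d p).real (shift (n • x) ⁻¹' A ∩ B)) atTop
      (𝓝 ((percolation d p).real A * (percolation d p).real B)) := by
  have hBm := measurableSet_of_mem_envCylinders hB
  induction A, hA using MeasurableSpace.induction_on_inter
    (s := envCylinders d) generateFrom_squareCylinders.symm isPiSystem_envCylinders with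
  | empty => simp
  | basic A hA =>
    obtain ⟨s, t, -, rfl⟩ := hA
    obtain ⟨s', t', -, rfl⟩ := hB
    -- For two cylinders the product formula is exact as soon as the translated support avoids the
    -- other one.
    refine tendsto_const_nhds.congr' ?_
    filter_upwards [eventually_disjoint_image_nsmul_add hx s s'] with n hn
    rw [← (measurePreserving_shift p (n • x)).measureReal_preimage
      (MeasurableSet.pi s.countable_toSet fun _ _ => MeasurableSet.of_discrete).nullMeasurableSet,
      preimage_shift_pi, measureReal_def, measureReal_def, measureReal_def,
      percolation_inter_pi p hn, ENNReal.toReal_mul]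
  | compl A hA ih =>
    have e : ∀ n : ℕ, (percolation d p).real (shift (n • x) ⁻¹' Aᶜ ∩ B)
        = (percolation d p).real B - (percolation d p).real (shift (n • x) ⁻¹' A ∩ B) := by
      intro n
      have := measureReal_inter_add_sdiff (μ := percolation d p) (s := B)
        (measurable_shift (n • x) hA)
      rw [Set.preimage_compl, Set.inter_comm _ B, Set.inter_comm _ B, ← Set.sdiff_eq]
      linarith
    simp_rw [e]
    have := tendsto_const_nhds (x := (percolation d p).real B) (f := atTop (α := ℕ)) |>.sub ih
    convert this using 2
    rw [probReal_compl_eq_one_sub hA]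
    ring
  | iUnion f hd hf ih =>
    have hs : ∀ g : ℕ → Set (Env d), (∀ i, MeasurableSet (g i)) →
        Pairwise (Function.onFun Disjoint g) → HasSum (fun i => (percolation d p).real (g i)) ((percolation d p).real (⋃ i, g i)) := by
      intro g hg hgd
      rw [measureReal_def, measure_iUnion hgd hg,
        ENNReal.tsum_toReal_eq fun i => measure_ne_top _ _]
      exact (ENNReal.summable_toReal
        (by rw [← measure_iUnion (μ := percolation d p) hgd hg]; exact measure_ne_top _ _)).hasSum
    have e : ∀ n : ℕ, (percolation d p).real (shift (n • x) ⁻¹' (⋃ i, f i) ∩ B)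
        = ∑' i, (percolation d p).real (shift (n • x) ⁻¹' (f i) ∩ B) := by
      intro n
      rw [Set.preimage_iUnion, Set.iUnion_inter]
      refine (hs _ (fun i => (measurable_shift _ (hf i)).inter hBm) fun i j hij => ?_).tsum_eq.symm
      exact ((hd hij).preimage _).mono Set.inter_subset_left Set.inter_subset_left
    simp_rw [e]
    rw [← ((hs f hf hd).mul_right _).tsum_eq]
    -- The bound is the probability of `f i`, uniform in `n` by shift invariance and summable by
    -- disjointness.
    refine tendsto_tsum_of_dominated_convergence (hs f hf hd).summable ih
      (Eventually.of_forall fun n i => ?_)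
    rw [Real.norm_of_nonneg measureReal_nonneg,
      ← (measurePreserving_shift p (n • x)).measureReal_preimage (hf i).nullMeasurableSet]
    exact measureReal_mono Set.inter_subset_left

/-- For an invariant set the mixing sequence is constant, so the set is independent of every
cylinder, hence of its own complement. -/
theorem ergodic_shift (p : unitInterval) {x : ZLattice d} (hx : x ≠ 0) :
    Ergodic (shift x) (percolation d p) where
  toMeasurePreserving := measurePreserving_shift p x
  toPreErgodic := ⟨fun A hA hinv => by
    have hinv' : ∀ n : ℕ, shift (n • x) ⁻¹' A = A := by
      intro n
      rw [← shift_iterate]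
      induction n with
      | zero => rfl
      | succ n ih => rw [Function.iterate_succ, Set.preimage_comp, ih, hinv]
    have hind : ∀ B ∈ envCylinders d, (percolation d p).real (A ∩ B)
        = (percolation d p).real A * (percolation d p).real B := by
      intro B hB
      have := tendsto_percolation_shift_inter p hx hB hA
      simp_rw [hinv'] at this
      exact tendsto_nhds_unique tendsto_const_nhds this
    have hrestr : (percolation d p).restrict A = percolation d p A • percolation d p := by
      refine ext_of_generate_finite (envCylinders d) generateFrom_squareCylinders.symm
        isPiSystem_envCylinders (fun B hB => ?_) (by simp)
      rw [Measure.restrict_apply (measurableSet_of_mem_envCylinders hB), Set.inter_comm,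
        Measure.smul_apply, smul_eq_mul]
      have := hind B hB
      rw [measureReal_def, measureReal_def, measureReal_def, ← ENNReal.toReal_mul] at this
      exact (ENNReal.toReal_eq_toReal_iff' (measure_ne_top _ _)
        (ENNReal.mul_ne_top (measure_ne_top _ _) (measure_ne_top _ _))).1 this
    have h0 : percolation d p A * percolation d p Aᶜ = 0 := by
      have := congrArg (fun μ => μ Aᶜ) hrestr
      simpa [Measure.restrict_apply hA.compl] using this.symm
    rw [eventuallyConst_set']
    rcases mul_eq_zero.1 h0 with h | h
    · exact .inl (ae_eq_empty.2 h)
    · exact .inr (ae_eq_univ.2 h)⟩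

end Shift

/-! ### The cluster size -/

section Cluster

variable {d : ℕ}

theorem mem_cluster_shift {ω : Env d} {x y z : ZLattice d} :
    z ∈ cluster (shift x ω) y ↔ x + z ∈ cluster ω (x + y) := by
  have aux : ∀ (ω : Env d) (x y z : ZLattice d), z ∈ cluster (shift x ω) y →
      x + z ∈ cluster ω (x + y) := by
    rintro ω x y z ⟨w, hw⟩
    let φ : latticeGraph d →g latticeGraph d :=
      ⟨fun v => x + v, fun {a b} h => by
        change l1Norm (x + a - (x + b)) = 1
        rw [add_sub_add_left_eq_sub]; exact h⟩
    refine ⟨w.map φ, fun v hv => ?_⟩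
    rw [SimpleGraph.Walk.support_map, List.mem_map] at hv
    obtain ⟨u, hu, rfl⟩ := hv
    exact hw u hu
  refine ⟨aux ω x y z, fun h => ?_⟩
  -- The converse is the direct implication for the opposite shift.
  have := aux (shift x ω) (-x) (x + y) (x + z) (by rwa [shift_shift, add_neg_cancel, shift_zero])
  simpa using this

theorem clusterSize_shift (ω : Env d) (x : ZLattice d) :
    clusterSize (shift x ω) 0 = clusterSize ω x := by
  have e : cluster ω x = (x + ·) '' cluster (shift x ω) 0 := by
    ext z
    constructor
    · intro hz
      exact ⟨-x + z, by rw [mem_cluster_shift]; simpa using hz, by simp⟩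
    · rintro ⟨y, hy, rfl⟩
      simpa using mem_cluster_shift.1 hy
  rw [clusterSize, clusterSize, e, (add_right_injective x).encard_image]

theorem clusterCard_shift (ω : Env d) (x : ZLattice d) :
    clusterCard (shift x ω) 0 = clusterCard ω x := by
  rw [clusterCard, clusterCard, clusterSize_shift]

/-- A connection is witnessed by one walk, which involves finitely many coordinates. -/
theorem isOpen_mem_cluster (x y : ZLattice d) : IsOpen {ω : Env d | y ∈ cluster ω x} := by
  have e : {ω : Env d | y ∈ cluster ω x}
      = ⋃ w : (latticeGraph d).Walk x y, ⋂ v ∈ w.support.toFinset, {ω : Env d | ω v = true} := by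
    ext ω; simp [cluster]
  rw [e]
  refine isOpen_iUnion fun w => isOpen_biInter_finset fun v _ => ?_
  exact (isOpen_discrete ({true} : Set Bool)).preimage (continuous_apply (A := fun _ => Bool) v)

theorem isOpen_le_clusterSize (n : ℕ) (x : ZLattice d) :
    IsOpen {ω : Env d | (n : ℕ∞) ≤ clusterSize ω x} := by
  have e : {ω : Env d | (n : ℕ∞) ≤ clusterSize ω x}
      = ⋃ s : {s : Finset (ZLattice d) // s.card = n},
        ⋂ y ∈ s.1, {ω : Env d | y ∈ cluster ω x} := by
    ext ω
    simp only [Set.mem_iUnion, Set.mem_iInter, Subtype.exists]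
    constructor
    · intro h
      obtain ⟨t, ht, htn⟩ := Set.exists_subset_encard_eq (s := cluster ω x) h
      have hf : t.Finite := Set.finite_of_encard_eq_coe htn
      refine ⟨hf.toFinset, ?_, fun y hy => ht (hf.mem_toFinset.1 hy)⟩
      rw [hf.encard_eq_coe_toFinset_card] at htn
      exact_mod_cast htn
    · rintro ⟨s, rfl, hs⟩
      change _ ≤ (cluster ω x).encard
      rw [← Set.encard_coe_eq_coe_finsetCard]
      exact Set.encard_le_encard hs
  rw [e]
  exact isOpen_iUnion fun s => isOpen_biInter_finset fun y _ => isOpen_mem_cluster x y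

theorem measurable_clusterSize (x : ZLattice d) :
    Measurable fun ω : Env d => clusterSize ω x := by
  refine measurable_to_countable' fun n => ?_
  have hle : ∀ n : ℕ, MeasurableSet {ω : Env d | (n : ℕ∞) ≤ clusterSize ω x} :=
    fun n => (isOpen_le_clusterSize n x).measurableSet
  induction n using ENat.recTopCoe with
  | top =>
    have e : (fun ω : Env d => clusterSize ω x) ⁻¹' {⊤}
        = ⋂ n : ℕ, {ω : Env d | (n : ℕ∞) ≤ clusterSize ω x} := by
      ext ω
      simp [ENat.eq_top_iff_forall_ge]
    rw [e]
    exact MeasurableSet.iInter hle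
  | coe n =>
    have e : (fun ω : Env d => clusterSize ω x) ⁻¹' {(n : ℕ∞)}
        = {ω : Env d | (n : ℕ∞) ≤ clusterSize ω x}
          \ {ω : Env d | ((n + 1 : ℕ) : ℕ∞) ≤ clusterSize ω x} := by
      ext ω
      simp only [Set.mem_preimage, Set.mem_singleton_iff, Set.mem_sdiff, Set.mem_ofPred_eq, not_le,
        Nat.cast_add, Nat.cast_one]
      rw [ENat.lt_add_one_iff (ENat.natCast_ne_top n)]
      exact ⟨fun h => ⟨h.ge, h.le⟩, fun h => le_antisymm h.2 h.1⟩
    rw [e]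
    exact (hle n).diff (hle (n + 1))

theorem measurable_clusterNat (x : ZLattice d) :
    Measurable fun ω : Env d => (clusterSize ω x).toNat :=
  (Measurable.of_discrete (f := ENat.toNat)).comp (measurable_clusterSize x)

theorem measurable_clusterCard (x : ZLattice d) : Measurable fun ω : Env d => clusterCard ω x :=
  (Measurable.of_discrete (f := fun n : ℕ => (n : ℝ))).comp (measurable_clusterNat x)

/-- Below the decay rate the cluster size has exponential tails. -/
theorem eventually_percolation_le_clusterSize {p : unitInterval} {β : ℝ} (hβ : 0 ≤ β)
    (hβξ : β < decayRate d p) :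
    ∃ b, β < b ∧ ∀ᶠ n : ℕ in atTop,
      (percolation d p).real {ω | (n : ℕ∞) ≤ clusterSize ω 0} ≤ Real.exp (-(b * n)) := by
  -- The lower limit is the supremum of the eventual lower bounds. This set is nonempty because
  -- `sSup ∅ = 0` in `ℝ`, while `0 ≤ β < decayRate d p`.
  obtain ⟨b, hb, hβb⟩ := exists_lt_of_lt_csSup (s := {a : ℝ | ∀ᶠ n : ℕ in atTop, a ≤ -((1 / (n : ℝ)) *
      Real.log ((percolation d p).real {ω | (n : ℕ∞) ≤ clusterSize ω 0}))}) (by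
    by_contra h
    rw [Set.not_nonempty_iff_eq_empty] at h
    rw [decayRate, liminf_eq, h, Real.sSup_empty] at hβξ
    exact hβξ.not_ge hβ) (by rw [← liminf_eq]; exact hβξ)
  refine ⟨b, hβb, ?_⟩
  filter_upwards [hb, eventually_gt_atTop 0] with n hn hn0
  have hn0' : (0 : ℝ) < n := by exact_mod_cast hn0
  -- Probability zero is treated apart, since `Real.log 0 = 0` carries no information.
  rcases (measureReal_nonneg (μ := percolation d p)
    (s := {ω | (n : ℕ∞) ≤ clusterSize ω 0})).eq_or_lt with h | h
  · rw [← h]; positivity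
  · rw [← Real.log_le_iff_le_exp h]
    have : b * n ≤ -(1 / (n : ℝ) * Real.log
        ((percolation d p).real {ω | (n : ℕ∞) ≤ clusterSize ω 0})) * n := by gcongr
    have e : -(1 / (n : ℝ) * Real.log
        ((percolation d p).real {ω | (n : ℕ∞) ≤ clusterSize ω 0})) * n
        = -Real.log ((percolation d p).real {ω | (n : ℕ∞) ≤ clusterSize ω 0}) := by
      field_simp
    linarith

/-- With `b` strictly between `β` and the decay rate, `e^{βn} ℙ(C_0 = n)` is eventually at most
`e^{-(b-β)n}`, a geometric term. -/
theorem integrable_exp_clusterCard {p : unitInterval} {β : ℝ} (hβ : 0 ≤ β)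
    (hβξ : β < decayRate d p) :
    Integrable (fun ω => Real.exp (β * clusterCard ω 0)) (percolation d p) := by
  have hmN := measurable_clusterNat (d := d) 0
  suffices h : Integrable (fun n : ℕ => Real.exp (β * n))
      ((percolation d p).map fun ω => (clusterSize ω 0).toNat) from
    h.comp_measurable hmN
  obtain ⟨b, hb, hev⟩ := eventually_percolation_le_clusterSize hβ hβξ
  have hprob : IsProbabilityMeasure ((percolation d p).map fun ω => (clusterSize ω 0).toNat) :=
    Measure.isProbabilityMeasure_map hmN.aemeasurable
  have hgeo : Summable fun n : ℕ => Real.exp (-(b - β)) ^ n :=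
    summable_geometric_of_lt_one (Real.exp_pos _).le (Real.exp_lt_one_iff.2 (by linarith))
  have hsum : Summable fun n : ℕ => Real.exp (β * n)
      * ((percolation d p).map fun ω => (clusterSize ω 0).toNat).real {n} := by
    refine Summable.of_norm_bounded_eventually_nat hgeo ?_
    filter_upwards [hev, eventually_gt_atTop 0] with n hn hn0
    rw [Real.norm_of_nonneg (by positivity), map_measureReal_apply hmN (measurableSet_singleton _),
      ← Real.exp_nat_mul, show (n : ℝ) * -(b - β) = β * n + -(b * n) by ring, Real.exp_add]
    gcongr
    refine (measureReal_mono fun ω hω => ?_).trans hn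
    have hω' : (clusterSize ω 0).toNat = n := hω
    change (n : ℕ∞) ≤ clusterSize ω 0
    rw [← hω']
    exact ENat.natCast_toNat_le_self _
  refine ⟨Measurable.of_discrete.aestronglyMeasurable, ?_⟩
  rw [hasFiniteIntegral_iff_ofReal (ae_of_all _ fun n => (Real.exp_pos _).le), lintegral_countable']
  refine lt_of_eq_of_lt (tsum_congr fun n => ?_) hsum.tsum_ofReal_lt_top
  rw [ENNReal.ofReal_mul (Real.exp_pos _).le, ofReal_measureReal]

end Cluster

/-! ### Random compositions of measure preserving maps -/

section SkewProduct

variable {Ω E : Type*}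

/-- The sequence `e, η 0, η 1, …`. -/
def consSeq (e : E) (η : ℕ → E) : ℕ → E
  | 0 => e
  | n + 1 => η n

/-- The skew product `(ω, η) ↦ (τ (η 0) ω, (η 1, η 2, …))`. -/
def skewShift (τ : E → Ω → Ω) (z : Ω × (ℕ → E)) : Ω × (ℕ → E) :=
  (τ (z.2 0) z.1, fun n => z.2 (n + 1))

theorem skewShift_consSeq (τ : E → Ω → Ω) (ω : Ω) (e : E) (η : ℕ → E) :
    skewShift τ (ω, consSeq e η) = (τ e ω, η) := rfl

/-- Padding with `Set.univ` makes the support an initial segment, so that cylinders can be handled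
by induction on their length. -/
theorem exists_pi_eq_pi_range [MeasurableSpace E] (s : Finset ℕ) (t : ℕ → Set E)
    (ht : ∀ i, MeasurableSet (t i)) : ∃ (n : ℕ) (t' : ℕ → Set E), (∀ i, MeasurableSet (t' i)) ∧
      s ⊆ Finset.range n ∧ (∀ i ∈ s, t' i = t i) ∧ (∀ i ∉ s, t' i = Set.univ) ∧
      (s : Set ℕ).pi t = (Finset.range n : Set ℕ).pi t' := by
  have hsub : s ⊆ Finset.range (s.sup id + 1) := s.subset_range_sup_succ
  have h1 : ∀ i ∈ s, s.piecewise t (fun _ => Set.univ) i = t i :=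
    fun i hi => Finset.piecewise_eq_of_mem _ _ _ hi
  have h2 : ∀ i ∉ s, s.piecewise t (fun _ => Set.univ) i = Set.univ :=
    fun i hi => Finset.piecewise_eq_of_notMem _ _ _ hi
  refine ⟨s.sup id + 1, s.piecewise t fun _ => Set.univ, fun i => ?_, hsub, h1, h2, ?_⟩
  · by_cases hi : i ∈ s
    · rw [h1 i hi]; exact ht i
    · rw [h2 i hi]; exact .univ
  · ext η
    simp only [Set.mem_pi, Finset.mem_coe]
    constructor
    · intro h i _
      by_cases hi : i ∈ s
      · rw [h1 i hi]; exact h i hi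
      · rw [h2 i hi]; trivial
    · intro h i hi
      rw [← h1 i hi]; exact h i (hsub hi)

theorem preimage_consSeq_pi_range (n : ℕ) (t : ℕ → Set E) :
    (fun z : E × (ℕ → E) => consSeq z.1 z.2) ⁻¹' (Finset.range (n + 1) : Set ℕ).pi t
      = t 0 ×ˢ (Finset.range n : Set ℕ).pi fun i => t (i + 1) := by
  ext ⟨e, η⟩
  simp only [Set.mem_preimage, Set.mem_pi, Finset.mem_coe, Finset.mem_range, Set.mem_prod]
  constructor
  · exact fun h => ⟨h 0 (Nat.succ_pos n), fun i hi => h (i + 1) (Nat.succ_lt_succ hi)⟩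
  · rintro ⟨h0, h⟩ i hi
    cases i with
    | zero => exact h0
    | succ i => exact h i (Nat.lt_of_succ_lt_succ hi)

variable [MeasurableSpace Ω] [MeasurableSpace E] {ν : Measure E} [IsProbabilityMeasure ν]

theorem eq_infinitePi_of_pi_range {ρ : Measure (ℕ → E)}
    (h : ∀ (n : ℕ) (t : ℕ → Set E), (∀ i, MeasurableSet (t i)) →
      ρ ((Finset.range n : Set ℕ).pi t) = ∏ i ∈ Finset.range n, ν (t i)) :
    ρ = Measure.infinitePi fun _ : ℕ => ν := by
  refine Measure.eq_infinitePi _ fun s t ht => ?_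
  obtain ⟨n, t', ht', hsub, h1, h2, e⟩ := exists_pi_eq_pi_range s t ht
  rw [e, h n t' ht', ← Finset.prod_subset hsub fun i _ hi => by rw [h2 i hi, measure_univ]]
  exact Finset.prod_congr rfl fun i hi => by rw [h1 i hi]

theorem measurable_consSeq : Measurable fun z : E × (ℕ → E) => consSeq z.1 z.2 := by
  refine measurable_pi_lambda _ fun n => ?_
  cases n with
  | zero => exact measurable_fst
  | succ n => exact (measurable_pi_apply n).comp measurable_snd

theorem measurableSet_pi_range {t : ℕ → Set E} (ht : ∀ i, MeasurableSet (t i)) (n : ℕ) :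
    MeasurableSet ((Finset.range n : Set ℕ).pi t) :=
  MeasurableSet.pi (Finset.countable_toSet _) fun i _ => ht i

theorem measurePreserving_consSeq :
    MeasurePreserving (fun z : E × (ℕ → E) => consSeq z.1 z.2)
      (ν.prod (Measure.infinitePi fun _ : ℕ => ν)) (Measure.infinitePi fun _ : ℕ => ν) where
  measurable := measurable_consSeq
  map_eq := by
    refine eq_infinitePi_of_pi_range fun n t ht => ?_
    rw [Measure.map_apply measurable_consSeq (measurableSet_pi_range ht n)]
    cases n with
    | zero => simp
    | succ n =>
      rw [preimage_consSeq_pi_range, Measure.prod_prod,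
        Measure.infinitePi_pi _ fun i _ => ht (i + 1), Finset.prod_range_succ', mul_comm]

theorem infinitePi_eq_lintegral_consSeq {D : Set (ℕ → E)} (hD : MeasurableSet D) :
    Measure.infinitePi (fun _ : ℕ => ν) D
      = ∫⁻ e, Measure.infinitePi (fun _ : ℕ => ν) {η | consSeq e η ∈ D} ∂ν := by
  rw [← measurePreserving_consSeq.measure_preimage hD.nullMeasurableSet,
    Measure.prod_apply (measurable_consSeq hD)]
  rfl

variable {τ : E → Ω → Ω} {m : Measure Ω} [IsProbabilityMeasure m]

theorem measurable_skewShift (hτ : Measurable (Function.uncurry τ)) :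
    Measurable (skewShift τ) := by
  refine Measurable.prodMk ?_ (measurable_pi_lambda _ fun n =>
    (measurable_pi_apply (n + 1)).comp measurable_snd)
  have h0 : Measurable fun z : Ω × (ℕ → E) => z.2 0 :=
    (measurable_pi_apply 0).comp measurable_snd
  exact hτ.comp (h0.prodMk measurable_fst)

/-- Fubini in the first coordinate `e` of the sequence: the remaining coordinates still have the
product law, and each `τ e` preserves `m`. -/
theorem measurePreserving_skewShift (hτ : Measurable (Function.uncurry τ))
    (hp : ∀ e, MeasurePreserving (τ e) m m) :
    MeasurePreserving (skewShift τ) (m.prod (Measure.infinitePi fun _ : ℕ => ν))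
      (m.prod (Measure.infinitePi fun _ : ℕ => ν)) where
  measurable := measurable_skewShift hτ
  map_eq := by
    ext A hA
    have hg : Measurable fun ω => Measure.infinitePi (fun _ : ℕ => ν) (Prod.mk ω ⁻¹' A) :=
      measurable_measure_prodMk_left hA
    rw [Measure.map_apply (measurable_skewShift hτ) hA,
      Measure.prod_apply (measurable_skewShift hτ hA), Measure.prod_apply hA]
    have e1 : ∀ ω, Measure.infinitePi (fun _ : ℕ => ν) (Prod.mk ω ⁻¹' (skewShift τ ⁻¹' A))
        = ∫⁻ e, Measure.infinitePi (fun _ : ℕ => ν) (Prod.mk (τ e ω) ⁻¹' A) ∂ν := fun ω =>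
      infinitePi_eq_lintegral_consSeq (measurable_prodMk_left (measurable_skewShift hτ hA))
    simp_rw [e1]
    rw [lintegral_lintegral_swap]
    · have e2 : ∀ e, ∫⁻ ω, Measure.infinitePi (fun _ : ℕ => ν) (Prod.mk (τ e ω) ⁻¹' A) ∂m
          = ∫⁻ ω, Measure.infinitePi (fun _ : ℕ => ν) (Prod.mk ω ⁻¹' A) ∂m := fun e =>
        (hp e).lintegral_comp hg
      simp_rw [e2]
      simp
    · exact (hg.comp (hτ.comp measurable_swap)).aemeasurable

/-- A bounded function which is harmonic for the random composition is invariant. -/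
theorem ae_ae_eq_of_harmonic (hτ : Measurable (Function.uncurry τ))
    (hp : ∀ e, MeasurePreserving (τ e) m m) {g : Ω → ℝ} (hg : Measurable g)
    (hb : ∀ ω, ‖g ω‖ ≤ 1) (hh : ∀ ω, g ω = ∫ e, g (τ e ω) ∂ν) :
    ∀ᵐ e ∂ν, ∀ᵐ ω ∂m, g (τ e ω) = g ω := by
  have hm1 : Measurable fun z : Ω × E => g (τ z.2 z.1) := hg.comp (hτ.comp measurable_swap)
  have hm2 : Measurable fun z : Ω × E => g z.1 := hg.comp measurable_fst
  have hb2 : ∀ a b : ℝ, ‖a‖ ≤ 1 → ‖b‖ ≤ 1 → ‖a * b‖ ≤ 1 := fun a b ha hb => by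
    rw [norm_mul]; exact mul_le_one₀ ha (norm_nonneg _) hb
  have i11 : Integrable (fun z : Ω × E => g (τ z.2 z.1) * g (τ z.2 z.1)) (m.prod ν) :=
    Integrable.of_bound (hm1.mul hm1).aestronglyMeasurable 1
      (ae_of_all _ fun z => hb2 _ _ (hb _) (hb _))
  have i12 : Integrable (fun z : Ω × E => g z.1 * g (τ z.2 z.1)) (m.prod ν) :=
    Integrable.of_bound (hm2.mul hm1).aestronglyMeasurable 1
      (ae_of_all _ fun z => hb2 _ _ (hb _) (hb _))
  have i22 : Integrable (fun z : Ω × E => g z.1 * g z.1) (m.prod ν) :=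
    Integrable.of_bound (hm2.mul hm2).aestronglyMeasurable 1
      (ae_of_all _ fun z => hb2 _ _ (hb _) (hb _))
  have v22 : ∫ z, g z.1 * g z.1 ∂(m.prod ν) = ∫ ω, g ω * g ω ∂m := by
    rw [integral_prod _ i22]; simp
  have v12 : ∫ z, g z.1 * g (τ z.2 z.1) ∂(m.prod ν) = ∫ ω, g ω * g ω ∂m := by
    rw [integral_prod _ i12]
    refine integral_congr_ae (ae_of_all _ fun ω => ?_)
    simp only
    rw [integral_const_mul, ← hh ω]
  have v11 : ∫ z, g (τ z.2 z.1) * g (τ z.2 z.1) ∂(m.prod ν) = ∫ ω, g ω * g ω ∂m := by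
    rw [integral_prod_symm _ i11]
    have : ∀ e, ∫ ω, g (τ e ω) * g (τ e ω) ∂m = ∫ ω, g ω * g ω ∂m := fun e => by
      conv_rhs => rw [← (hp e).map_eq]
      exact (integral_map (hp e).aemeasurable (hg.mul hg).aestronglyMeasurable).symm
    simp only [this]
    simp
  -- Expanding the square, the outer terms equal `∫ g²` by invariance of `m`, and the cross term
  -- equals `∫ g²` by harmonicity.
  have key : ∫ z, (g (τ z.2 z.1) - g z.1) ^ 2 ∂(m.prod ν) = 0 := by
    have e : ∀ z : Ω × E, (g (τ z.2 z.1) - g z.1) ^ 2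
        = g (τ z.2 z.1) * g (τ z.2 z.1) - 2 * (g z.1 * g (τ z.2 z.1)) + g z.1 * g z.1 :=
      fun z => by ring
    simp_rw [e]
    have i3 : Integrable (fun z : Ω × E => g (τ z.2 z.1) * g (τ z.2 z.1)
        - 2 * (g z.1 * g (τ z.2 z.1))) (m.prod ν) := i11.sub (i12.const_mul 2)
    rw [integral_add i3 i22, integral_sub i11 (i12.const_mul 2),
      integral_const_mul, v11, v12, v22]
    ring
  have hi : Integrable (fun z : Ω × E => (g (τ z.2 z.1) - g z.1) ^ 2) (m.prod ν) :=
    Integrable.of_bound ((hm1.sub hm2).pow_const 2).aestronglyMeasurable 4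
      (ae_of_all _ fun z => by
        have h1 := abs_le.1 (hb (τ z.2 z.1))
        have h2 := abs_le.1 (hb z.1)
        rw [Real.norm_of_nonneg (sq_nonneg _)]
        nlinarith)
  rw [integral_eq_zero_iff_of_nonneg (fun z => sq_nonneg _) hi] at key
  have key' := Measure.ae_ae_of_ae_prod ((Measure.measurePreserving_swap
    (μ := ν) (ν := m)).quasiMeasurePreserving.ae key)
  filter_upwards [key'] with e he
  filter_upwards [he] with ω hω
  have hω' : (g (τ e ω) - g ω) ^ 2 = 0 := hω
  exact sub_eq_zero.1 (pow_eq_zero_iff two_ne_zero |>.1 hω')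

/-- The skew product is ergodic as soon as some of the maps are. -/
theorem ergodic_skewShift (hτ : Measurable (Function.uncurry τ))
    (hp : ∀ e, MeasurePreserving (τ e) m m) {D : Set E} (hD : ν D ≠ 0)
    (herg : ∀ e ∈ D, Ergodic (τ e) m) :
    Ergodic (skewShift τ) (m.prod (Measure.infinitePi fun _ : ℕ => ν)) where
  toMeasurePreserving := measurePreserving_skewShift hτ hp
  toPreErgodic := ⟨fun A hA hinv => by
    set μ := Measure.infinitePi fun _ : ℕ => ν with hμ
    have hsec : ∀ ω e η, (ω, consSeq e η) ∈ A ↔ (τ e ω, η) ∈ A := fun ω e η => by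
      rw [← skewShift_consSeq, ← Set.mem_preimage (f := skewShift τ), hinv]
    have hgm : Measurable fun ω => μ (Prod.mk ω ⁻¹' A) := measurable_measure_prodMk_left hA
    have hh : ∀ ω, μ (Prod.mk ω ⁻¹' A) = ∫⁻ e, μ (Prod.mk (τ e ω) ⁻¹' A) ∂ν := fun ω => by
      rw [hμ, infinitePi_eq_lintegral_consSeq (measurable_prodMk_left hA)]
      refine lintegral_congr fun e => ?_
      congr 1
      ext η
      exact hsec ω e η
    have hae := ae_ae_eq_of_harmonic hτ hp (ν := ν) (g := fun ω => μ.real (Prod.mk ω ⁻¹' A))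
      hgm.ennreal_toReal (fun ω => by
        rw [Real.norm_of_nonneg measureReal_nonneg]; exact measureReal_le_one) (fun ω => by
        rw [measureReal_def, hh ω]
        exact (integral_toReal (hgm.comp (hτ.comp measurable_prodMk_right)).aemeasurable
          (ae_of_all _ fun e => measure_lt_top _ _)).symm)
    -- The fibre measure is invariant under almost every `τ e`, and `D` is not null; one ergodic map
    -- then makes it constant.
    obtain ⟨e, heD, he⟩ : ∃ e ∈ D, ∀ᵐ ω ∂m, μ.real (Prod.mk (τ e ω) ⁻¹' A)
        = μ.real (Prod.mk ω ⁻¹' A) := by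
      by_contra! hne
      refine hD (measure_mono_null (fun e he => ?_) hae)
      exact fun h => hne e he (Eventually.mono h fun _ hx => not_not.2 hx)
    obtain ⟨c, hc⟩ := (herg e heD).quasiErgodic.ae_eq_const_of_ae_eq_comp_ae
      hgm.ennreal_toReal.aestronglyMeasurable he
    have hc' : ∀ᵐ ω ∂m, μ (Prod.mk ω ⁻¹' A) = c.toNNReal := by
      filter_upwards [hc] with ω hω
      rw [← ofReal_measureReal (μ := μ)]
      exact congrArg ENNReal.ofReal hω
    -- Almost every fibre is independent of the first `n` coordinates. The induction strips the
    -- first coordinate `e`, which replaces the fibre over `ω` by the fibre over `τ e ω`; the almost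
    -- sure statement survives since `τ e` preserves `m`.
    have hcyl : ∀ (n : ℕ) (t : ℕ → Set E), (∀ i, MeasurableSet (t i)) →
        ∀ᵐ ω ∂m, μ (Prod.mk ω ⁻¹' A ∩ (Finset.range n : Set ℕ).pi t)
          = c.toNNReal * ∏ i ∈ Finset.range n, ν (t i) := by
      intro n
      induction n with
      | zero => intro t ht; simpa using hc'
      | succ n ih =>
        intro t ht
        have hC := measurableSet_pi_range (fun i => ht (i + 1)) n
        have hmeas : Measurable fun ω => μ (Prod.mk ω ⁻¹' A ∩
            (Finset.range n : Set ℕ).pi fun i => t (i + 1)) :=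
          measurable_measure_prodMk_left (hA.inter (measurable_snd hC))
        have hstep : ∀ᵐ ω ∂m, ∀ᵐ e ∂ν, μ (Prod.mk (τ e ω) ⁻¹' A ∩
            (Finset.range n : Set ℕ).pi fun i => t (i + 1))
            = c.toNNReal * ∏ i ∈ Finset.range n, ν (t (i + 1)) := by
          rw [Measure.ae_ae_comm]
          · exact ae_of_all _ fun e => (hp e).quasiMeasurePreserving.ae (ih _ fun i => ht (i + 1))
          · exact measurableSet_eq_fun (hmeas.comp (hτ.comp measurable_swap)) measurable_const
        filter_upwards [hstep] with ω hω
        rw [hμ, infinitePi_eq_lintegral_consSeq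
          ((measurable_prodMk_left hA).inter (measurableSet_pi_range ht _)), ← hμ]
        have e1 : ∀ e, μ {η | consSeq e η ∈ Prod.mk ω ⁻¹' A ∩ (Finset.range (n + 1) : Set ℕ).pi t}
            = (t 0).indicator (fun e => μ (Prod.mk (τ e ω) ⁻¹' A ∩
              (Finset.range n : Set ℕ).pi fun i => t (i + 1))) e := by
          intro e
          have e2 : ∀ η, consSeq e η ∈ Prod.mk ω ⁻¹' A ∩ (Finset.range (n + 1) : Set ℕ).pi t ↔
              e ∈ t 0 ∧ η ∈ Prod.mk (τ e ω) ⁻¹' A ∩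
                (Finset.range n : Set ℕ).pi fun i => t (i + 1) := by
            intro η
            have := Set.ext_iff.1 (preimage_consSeq_pi_range n t) (e, η)
            rw [Set.mem_prod] at this
            rw [Set.mem_inter_iff, Set.mem_inter_iff, and_left_comm]
            exact and_congr (hsec ω e η) this
          by_cases he : e ∈ t 0
          · rw [Set.indicator_of_mem he]
            congr 1
            ext η
            exact (e2 η).trans (and_iff_right he)
          · rw [Set.indicator_of_notMem he]
            refine measure_mono_null (fun η hη => ?_) measure_empty
            exact absurd ((e2 η).1 hη).1 he
        simp_rw [e1]
        rw [lintegral_indicator (ht 0), lintegral_congr_ae (ae_restrict_of_ae hω),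
          lintegral_const, Measure.restrict_apply_univ, Finset.prod_range_succ', mul_assoc]
    have hrestr : (c.toNNReal • m).prod μ = (m.prod μ).restrict A := by
      refine Measure.prod_eq_generateFrom (C := {s | MeasurableSet s})
        (D := squareCylinders fun _ : ℕ => {s : Set E | MeasurableSet s})
        MeasurableSpace.generateFrom_measurableSet generateFrom_squareCylinders
        MeasurableSpace.isPiSystem_measurableSet
        (isPiSystem_squareCylinders (fun _ => MeasurableSpace.isPiSystem_measurableSet)
          fun _ => by simp)
        (Measure.toFiniteSpanningSetsIn _)
        ⟨fun _ => Set.univ, fun _ => ⟨∅, fun _ => Set.univ, by simp, by simp⟩,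
          fun _ => measure_lt_top _ _, Set.iUnion_const _⟩ ?_
      rintro B hB _ ⟨s, t, ht, rfl⟩
      obtain ⟨n, t', ht', -, -, -, e⟩ := exists_pi_eq_pi_range s t (fun i => by
        simpa using ht i (Set.mem_univ i))
      have hBm : MeasurableSet B := hB
      have hC := measurableSet_pi_range ht' n
      rw [e, Measure.restrict_apply (hBm.prod hC), Measure.prod_apply ((hBm.prod hC).inter hA)]
      have e1 : ∀ ω, μ (Prod.mk ω ⁻¹' (B ×ˢ (Finset.range n : Set ℕ).pi t' ∩ A))
          = B.indicator (fun ω => μ (Prod.mk ω ⁻¹' A ∩ (Finset.range n : Set ℕ).pi t')) ω := by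
        intro ω
        by_cases hω : ω ∈ B
        · rw [Set.indicator_of_mem hω]
          congr 1
          ext η
          simp [hω, and_comm]
        · rw [Set.indicator_of_notMem hω]
          refine measure_mono_null (fun η hη => ?_) measure_empty
          exact absurd hη.1.1 hω
      simp_rw [e1]
      rw [lintegral_indicator hBm, lintegral_congr_ae (ae_restrict_of_ae (hcyl n t' ht')),
        lintegral_const, Measure.restrict_apply_univ, hμ, Measure.infinitePi_pi _ fun i _ => ht' i]
      simp only [Measure.smul_apply, ENNReal.smul_def, smul_eq_mul]
      ring
    have hsm : (c.toNNReal : ℝ≥0∞) • (m.prod μ) = (m.prod μ).restrict A := by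
      rw [← hrestr]
      exact (Measure.prod_smul_left _).symm
    rw [eventuallyConst_set']
    -- The measure restricted to `A` is `c` times the whole measure; evaluated at the complement of
    -- `A` it vanishes.
    have h0 : (c.toNNReal : ℝ≥0∞) * (m.prod μ) Aᶜ = 0 := by
      have := congrArg (fun ρ => ρ Aᶜ) hsm
      simpa [Measure.restrict_apply hA.compl] using this
    rcases mul_eq_zero.1 h0 with h | h
    · refine .inl (ae_eq_empty.2 ?_)
      have := congrArg (fun ρ => ρ Set.univ) hsm
      rw [h] at this
      simpa using this.symm
    · exact .inr (ae_eq_univ.2 h)⟩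

end SkewProduct

/-! ### Jump times of right-continuous paths -/

section Paths

variable {V : Type*} {y : ℝ≥0 → V}

theorem jumpTime_le_succ (n : ℕ) : jumpTime y n ≤ jumpTime y (n + 1) :=
  le_iInf₂ fun _ ht => ht.1.le

theorem eq_skeleton_of_mem {n : ℕ} {t : ℝ≥0} (h1 : jumpTime y n ≤ t)
    (h2 : t < jumpTime y (n + 1)) : y t = skeleton y n := by
  rcases h1.eq_or_lt with h | h
  · rw [skeleton, h, ENNReal.toNNReal_coe]
  · by_contra hne
    exact h2.not_ge (iInf₂_le (f := fun (t : ℝ≥0) (_ : jumpTime y n < (t : ℝ≥0∞) ∧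
      y t ≠ y (jumpTime y n).toNNReal) => (t : ℝ≥0∞)) t ⟨h, hne⟩)

theorem exists_forall_Ioo_eq (hy : ∀ t, ∀ᶠ s in 𝓝[>] t, y s = y t) (t : ℝ≥0) :
    ∃ u, t < u ∧ ∀ s, t < s → s < u → y s = y t := by
  obtain ⟨u, hu, hsub⟩ := mem_nhdsGT_iff_exists_Ioo_subset.1 (hy t)
  exact ⟨u, hu, fun s hs1 hs2 => hsub ⟨hs1, hs2⟩⟩

theorem jumpTime_lt_succ (hy : ∀ t, ∀ᶠ s in 𝓝[>] t, y s = y t) {n : ℕ}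
    (h : jumpTime y n < ⊤) : jumpTime y n < jumpTime y (n + 1) := by
  obtain ⟨u, hu, hc⟩ := exists_forall_Ioo_eq hy (jumpTime y n).toNNReal
  have hlt : jumpTime y n < u := by
    rwa [← ENNReal.coe_toNNReal h.ne, ENNReal.coe_lt_coe]
  refine hlt.trans_le (le_iInf₂ fun t ht => ?_)
  rw [ENNReal.coe_le_coe]
  by_contra! htu
  refine ht.2 (hc t ?_ htu)
  rw [← ENNReal.coe_lt_coe, ENNReal.coe_toNNReal h.ne]
  exact ht.1

/-- By right continuity a departure from the current state persists for a short while, so it is seen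
at a time of `D`. A countable `D` then gives measurability. -/
theorem jumpTime_succ_lt_iff (hy : ∀ t, ∀ᶠ s in 𝓝[>] t, y s = y t) {D : Set ℝ≥0} (hD : Dense D)
    (n : ℕ) (c : ℝ≥0∞) : jumpTime y (n + 1) < c ↔
      ∃ q ∈ D, (q : ℝ≥0∞) < c ∧ jumpTime y n < q ∧ y q ≠ skeleton y n := by
  constructor
  · intro h
    obtain ⟨t, ht⟩ := iInf_lt_iff.1 h
    obtain ⟨⟨h1, h2⟩, h3⟩ := iInf_lt_iff.1 ht
    obtain ⟨u, hu, hc⟩ := exists_forall_Ioo_eq hy t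
    obtain ⟨v, hv1, hv2⟩ : ∃ v : ℝ≥0, t < v ∧ (v : ℝ≥0∞) ≤ c := by
      obtain ⟨r, hr1, hr2⟩ := ENNReal.lt_iff_exists_nnreal_btwn.1 h3
      exact ⟨r, ENNReal.coe_lt_coe.1 hr1, hr2.le⟩
    obtain ⟨q, hq, hq1, hq2⟩ := hD.exists_between (lt_min hu hv1)
    refine ⟨q, hq, ?_, h1.trans (ENNReal.coe_lt_coe.2 hq1), ?_⟩
    · exact (ENNReal.coe_lt_coe.2 (hq2.trans_le (min_le_right _ _))).trans_le hv2
    · rw [hc q hq1 (hq2.trans_le (min_le_left _ _))]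
      exact h2
  · rintro ⟨q, -, hqc, hq1, hq2⟩
    exact (iInf₂_le (f := fun (t : ℝ≥0) (_ : jumpTime y n < (t : ℝ≥0∞) ∧
      y t ≠ y (jumpTime y n).toNNReal) => (t : ℝ≥0∞)) q ⟨hq1, hq2⟩).trans_lt hqc

end Paths

/-! ### Measurability of jump times and skeleton -/

section PathMeasurability

variable {V Ω' : Type*} [MeasurableSpace V] [Countable V] [MeasurableSingletonClass V]
  [MeasurableSpace Ω'] {Y : ℝ≥0 → Ω' → V}

/-- The point `(⌊n t⌋ + 1) / n`, for `n + 1` in place of `n`, of the grid just above `t`. -/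
noncomputable def gridAbove (n : ℕ) (t : ℝ≥0) : ℝ≥0 := (⌊t * (n + 1)⌋₊ + 1) / (n + 1)

theorem tendsto_gridAbove (t : ℝ≥0) :
    Tendsto (fun n => gridAbove n t) atTop (𝓝[>] t) := by
  refine tendsto_nhdsWithin_iff.2 ⟨?_, Eventually.of_forall fun n => ?_⟩
  · have h1 : Tendsto (fun n : ℕ => t + 1 / ((n : ℝ≥0) + 1)) atTop (𝓝 (t + 0)) :=
      tendsto_const_nhds.add (by
        rw [← NNReal.tendsto_coe]
        simpa using tendsto_one_div_add_atTop_nhds_zero_nat (𝕜 := ℝ))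
    rw [add_zero] at h1
    refine tendsto_of_tendsto_of_tendsto_of_le_of_le tendsto_const_nhds h1 (fun n => ?_)
      fun n => ?_
    · rw [gridAbove, le_div_iff₀ (by positivity)]
      exact (Nat.lt_floor_add_one _).le
    · change gridAbove n t ≤ t + 1 / ((n : ℝ≥0) + 1)
      rw [gridAbove, add_div]
      gcongr
      rw [div_le_iff₀ (by positivity)]
      exact Nat.floor_le (by positivity)
  · rw [Set.mem_Ioi, gridAbove, lt_div_iff₀ (by positivity)]
    exact Nat.lt_floor_add_one _

/-- Sampling at grid points just to the right of `t` is jointly measurable, and by right continuity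
into a discrete space the samples are eventually equal to the value at `t`. -/
theorem measurable_uncurry_of_right_continuous (hm : ∀ t, Measurable (Y t))
    (hr : ∀ a t, ∀ᶠ s in 𝓝[>] t, Y s a = Y t a) :
    Measurable fun z : Ω' × ℝ≥0 => Y z.2 z.1 := by
  have happ : ∀ n, Measurable fun z : Ω' × ℝ≥0 => Y (gridAbove n z.2) z.1 := by
    intro n
    have h1 : Measurable fun z : Ω' × ℕ => Y (((z.2 : ℝ≥0) + 1) / (n + 1)) z.1 :=
      measurable_from_prod_countable_left fun k => hm ((k + 1) / (n + 1))
    have h2 : Measurable fun z : Ω' × ℝ≥0 => ((z.1, ⌊z.2 * (n + 1)⌋₊) : Ω' × ℕ) :=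
      measurable_fst.prodMk (Nat.measurable_floor.comp (measurable_snd.mul_const _))
    have h3 := h1.comp h2
    exact h3
  have hev : ∀ z : Ω' × ℝ≥0, ∀ᶠ n in atTop, Y (gridAbove n z.2) z.1 = Y z.2 z.1 :=
    fun z => (tendsto_gridAbove z.2).eventually (hr z.1 z.2)
  refine measurable_to_countable' fun v => ?_
  have e : (fun z : Ω' × ℝ≥0 => Y z.2 z.1) ⁻¹' {v}
      = ⋃ N : ℕ, ⋂ n : ℕ, ⋂ _ : N ≤ n, {z | Y (gridAbove n z.2) z.1 = v} := by
    ext z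
    obtain ⟨N, hN⟩ := eventually_atTop.1 (hev z)
    simp only [Set.mem_preimage, Set.mem_singleton_iff, Set.mem_iUnion, Set.mem_iInter,
      Set.mem_ofPred_eq]
    constructor
    · intro h
      exact ⟨N, fun n hn => (hN n hn).trans h⟩
    · rintro ⟨M, hM⟩
      rw [← hN (max M N) (le_max_right _ _)]
      exact hM _ (le_max_left _ _)
  rw [e]
  exact MeasurableSet.iUnion fun N => MeasurableSet.iInter fun n => MeasurableSet.iInter fun _ =>
    happ n (measurableSet_singleton v)

theorem measurable_skeleton_of_measurable_jumpTime (hm : ∀ t, Measurable (Y t))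
    (hr : ∀ a t, ∀ᶠ s in 𝓝[>] t, Y s a = Y t a) {n : ℕ}
    (h : Measurable fun a => jumpTime (Y · a) n) :
    Measurable fun a => skeleton (Y · a) n :=
  (measurable_uncurry_of_right_continuous hm hr).comp
    (measurable_id.prodMk h.ennreal_toNNReal)

theorem measurable_jumpTime (hm : ∀ t, Measurable (Y t))
    (hr : ∀ a t, ∀ᶠ s in 𝓝[>] t, Y s a = Y t a) (n : ℕ) :
    Measurable fun a => jumpTime (Y · a) n := by
  induction n with
  | zero => exact measurable_const
  | succ n ih =>
    have hs := measurable_skeleton_of_measurable_jumpTime hm hr ih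
    obtain ⟨D, hDc, hD⟩ := TopologicalSpace.exists_countable_dense ℝ≥0
    refine measurable_of_Iio fun c => ?_
    have e : (fun a => jumpTime (Y · a) (n + 1)) ⁻¹' Set.Iio c
        = ⋃ q ∈ D, {a | (q : ℝ≥0∞) < c ∧ jumpTime (Y · a) n < q ∧ Y q a ≠ skeleton (Y · a) n} := by
      ext a
      simp only [Set.mem_preimage, Set.mem_Iio, Set.mem_iUnion, Set.mem_ofPred_eq, exists_prop]
      exact jumpTime_succ_lt_iff (hr a) hD n c
    rw [e]
    refine MeasurableSet.biUnion hDc fun q _ => ?_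
    exact (MeasurableSet.const _).inter ((measurableSet_lt ih measurable_const).inter
      (measurableSet_eq_fun (hm q) hs).compl)

theorem measurable_skeleton (hm : ∀ t, Measurable (Y t))
    (hr : ∀ a t, ∀ᶠ s in 𝓝[>] t, Y s a = Y t a) (n : ℕ) :
    Measurable fun a => skeleton (Y · a) n :=
  measurable_skeleton_of_measurable_jumpTime hm hr (measurable_jumpTime hm hr n)

/-- A right-continuous path in a discrete space is measurable. -/
theorem measurable_of_right_continuous {y : ℝ≥0 → V} (hy : ∀ t, ∀ᶠ s in 𝓝[>] t, y s = y t) :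
    Measurable y :=
  (measurable_uncurry_of_right_continuous (Ω' := Unit) (Y := fun t _ => y t)
    (fun _ => measurable_const) fun _ => hy).comp (measurable_const (a := ()) |>.prodMk measurable_id)

end PathMeasurability

/-! ### The driving sequence: steps and normalized holding times -/

section Exponential

theorem expMeasure_Ioi (v : ℝ) : expMeasure 1 (Set.Ioi v) = ENNReal.ofReal (Real.exp (-max v 0)) := by
  have := isProbabilityMeasure_expMeasure one_pos
  rw [← Set.compl_Iic, prob_compl_eq_one_sub measurableSet_Iic, ← ofReal_cdf,
    cdf_expMeasure_eq one_pos, ← ENNReal.ofReal_one, one_mul]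
  split_ifs with h
  · rw [max_eq_left h, ← ENNReal.ofReal_sub _ (by
      rw [sub_nonneg]; exact Real.exp_le_one_iff.2 (by linarith)), sub_sub_cancel]
  · rw [max_eq_right (not_le.1 h).le]; simp

theorem ae_nonneg_expMeasure : ∀ᵐ x ∂(expMeasure 1), 0 ≤ x := by
  have := isProbabilityMeasure_expMeasure one_pos
  have h : (expMeasure 1) (Set.Ioi (0 : ℝ))ᶜ = 0 := by
    rw [prob_compl_eq_zero_iff measurableSet_Ioi, expMeasure_Ioi]; simp
  filter_upwards [measure_eq_zero_iff_ae_notMem.1 h] with x hx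
  exact (not_not.1 hx : x ∈ Set.Ioi (0 : ℝ)).le

/-- The mean is the integral of the tail `e^{-t}`. -/
theorem lintegral_expMeasure : ∫⁻ x, ENNReal.ofReal x ∂(expMeasure 1) = 1 := by
  rw [lintegral_eq_lintegral_meas_lt _ ae_nonneg_expMeasure aemeasurable_id]
  have e : ∀ t ∈ Set.Ioi (0 : ℝ), expMeasure 1 {a : ℝ | t < a} = ENNReal.ofReal (Real.exp (-t)) :=
    fun t ht => by
      rw [show {a : ℝ | t < a} = Set.Ioi t from rfl, expMeasure_Ioi,
        max_eq_left (le_of_lt (Set.mem_Ioi.1 ht))]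
  rw [setLIntegral_congr_fun measurableSet_Ioi e, ← ofReal_integral_eq_lintegral_ofReal
    (by have := exp_neg_integrableOn_Ioi 0 one_pos; simpa [IntegrableOn] using this)
    (ae_of_all _ fun x => (Real.exp_pos _).le), integral_exp_neg_Ioi_zero, ENNReal.ofReal_one]

theorem integrable_id_expMeasure : Integrable (fun x : ℝ => x) (expMeasure 1) := by
  refine ⟨aestronglyMeasurable_id, ?_⟩
  rw [hasFiniteIntegral_iff_ofReal ae_nonneg_expMeasure, lintegral_expMeasure]
  exact ENNReal.one_lt_top

theorem integral_id_expMeasure : ∫ x, x ∂(expMeasure 1) = 1 := by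
  rw [integral_eq_lintegral_of_nonneg_ae ae_nonneg_expMeasure aestronglyMeasurable_id,
    lintegral_expMeasure, ENNReal.toReal_one]

end Exponential

/-! ### Step law and rates of the walk -/

section Steps

variable {d : ℕ} (l : EuclideanSpace ℝ (Fin d)) (lam : ℝ)

/-- The jump probabilities of the walk. -/
noncomputable def stepProb (e : ZLattice d) : ℝ :=
  (∑ e ∈ steps d, Real.exp (lam * dot l e))⁻¹ * Real.exp (lam * dot l e)

/-- The law of the jumps of the walk. -/
noncomputable def stepMeasure : Measure (ZLattice d) :=
  ∑ e ∈ steps d, ENNReal.ofReal (stepProb l lam e) • Measure.dirac e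

/-- The law of a jump and of a normalized holding time. -/
noncomputable def driveMeasure : Measure (ZLattice d × ℝ) := (stepMeasure l lam).prod (expMeasure 1)

theorem single_mem_steps (hd : 1 ≤ d) : (Pi.single ⟨0, hd⟩ 1 : ZLattice d) ∈ steps d := by
  rw [mem_steps]
  change l1Norm _ = 1
  rw [sub_zero, l1Norm, Finset.sum_eq_single ⟨0, hd⟩]
  · simp
  · intro k _ hk
    simp [Pi.single_eq_of_ne hk]
  · simp

theorem ne_zero_of_mem_steps {e : ZLattice d} (he : e ∈ steps d) : e ≠ 0 :=
  ((mem_steps e).1 he).ne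

theorem sum_exp_pos (hd : 1 ≤ d) : 0 < ∑ e ∈ steps d, Real.exp (lam * dot l e) :=
  Finset.sum_pos (fun _ _ => Real.exp_pos _) ⟨_, single_mem_steps hd⟩

theorem stepProb_pos (hd : 1 ≤ d) (e : ZLattice d) : 0 < stepProb l lam e :=
  mul_pos (inv_pos.2 (sum_exp_pos l lam hd)) (Real.exp_pos _)

theorem sum_stepProb (hd : 1 ≤ d) : ∑ e ∈ steps d, stepProb l lam e = 1 := by
  simp only [stepProb]
  rw [← Finset.mul_sum, inv_mul_cancel₀ (sum_exp_pos l lam hd).ne']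

theorem isProbabilityMeasure_stepMeasure (hd : 1 ≤ d) :
    IsProbabilityMeasure (stepMeasure l lam) := ⟨by
  simp only [stepMeasure, Measure.coe_finsetSum, Finset.sum_apply, Measure.smul_apply,
    measure_univ, smul_eq_mul, mul_one]
  rw [← ENNReal.ofReal_sum_of_nonneg fun e _ => (stepProb_pos l lam hd e).le,
    sum_stepProb l lam hd, ENNReal.ofReal_one]⟩

theorem isProbabilityMeasure_driveMeasure (hd : 1 ≤ d) :
    IsProbabilityMeasure (driveMeasure l lam) := by
  have := isProbabilityMeasure_expMeasure one_pos
  have := isProbabilityMeasure_stepMeasure l lam hd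
  unfold driveMeasure
  infer_instance

theorem stepMeasure_singleton (e : ZLattice d) :
    stepMeasure l lam {e} = if e ∈ steps d then ENNReal.ofReal (stepProb l lam e) else 0 := by
  simp only [stepMeasure, Measure.coe_finsetSum, Finset.sum_apply, Measure.smul_apply,
    smul_eq_mul, Measure.dirac_apply' _ (measurableSet_singleton e), Set.indicator_apply,
    Set.mem_singleton_iff, Pi.one_apply, mul_ite, mul_one, mul_zero]
  rw [Finset.sum_ite_eq' (steps d) e]

theorem driveMeasure_singleton_prod_Ioi (hd : 1 ≤ d) {e : ZLattice d} (he : e ∈ steps d) (v : ℝ) :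
    driveMeasure l lam ({e} ×ˢ Set.Ioi v)
      = ENNReal.ofReal (stepProb l lam e * Real.exp (-max v 0)) := by
  have := isProbabilityMeasure_expMeasure one_pos
  rw [driveMeasure, Measure.prod_prod, stepMeasure_singleton, if_pos he, expMeasure_Ioi,
    ENNReal.ofReal_mul (stepProb_pos l lam hd e).le]

theorem driveMeasure_singleton_prod_of_notMem {e : ZLattice d} (he : e ∉ steps d)
    (s : Set ℝ) : driveMeasure l lam ({e} ×ˢ s) = 0 := by
  have := isProbabilityMeasure_expMeasure one_pos
  rw [driveMeasure, Measure.prod_prod, stepMeasure_singleton, if_neg he, zero_mul]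

/-- The total jump rate at `x`. -/
noncomputable def jumpRate (β : ℝ) (ω : Env d) (x : ZLattice d) : ℝ :=
  Real.exp (-(β * clusterCard ω x))

theorem qMatrix_walkGenerator_self (hd : 1 ≤ d) (β : ℝ) (ω : Env d) (x : ZLattice d) :
    qMatrix (walkGenerator l lam β ω) x x = -jumpRate β ω x := by
  have h : ∀ e ∈ steps d, Real.exp (lam * dot l e - β * clusterCard ω x)
      * (Set.indicator {x} 1 (x + e) - Set.indicator {x} 1 x)
      = Real.exp (lam * dot l e) * -jumpRate β ω x := by
    intro e he
    rw [Set.indicator_of_notMem (by simpa using ne_zero_of_mem_steps he),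
      Set.indicator_of_mem (Set.mem_singleton x), sub_eq_add_neg (lam * _), Real.exp_add, jumpRate]
    simp
  rw [qMatrix, walkGenerator, Finset.sum_congr rfl h, ← Finset.sum_mul, ← mul_assoc,
    inv_mul_cancel₀ (sum_exp_pos l lam hd).ne', one_mul]

/-- The decisive factorization: the environment enters only through the total rate, not through the
choice of the step. -/
theorem qMatrix_walkGenerator_of_ne (β : ℝ) (ω : Env d) (x : ZLattice d) {e : ZLattice d}
    (he : e ∈ steps d) :
    qMatrix (walkGenerator l lam β ω) x (x + e) = stepProb l lam e * jumpRate β ω x := by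
  have h1 : ∀ e', Set.indicator {x + e} (1 : ZLattice d → ℝ) (x + e') = if e' = e then 1 else 0 :=
    fun e' => by simp [Set.indicator_apply]
  have h0 : Set.indicator {x + e} (1 : ZLattice d → ℝ) x = 0 := by
    refine Set.indicator_of_notMem (fun h => ne_zero_of_mem_steps he ?_) _
    simpa using Set.mem_singleton_iff.1 h
  simp only [qMatrix, walkGenerator, h1, h0, sub_zero, mul_ite, mul_one, mul_zero]
  rw [Finset.sum_ite_eq' (steps d) e, if_pos he, sub_eq_add_neg (lam * _), Real.exp_add, stepProb,
    jumpRate, mul_assoc]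

end Steps

/-! ### Steps and normalized holding times of the chain -/

section DrivingSequence

variable {d : ℕ} {l : EuclideanSpace ℝ (Fin d)} {lam β : ℝ} {ω : Env d}
  {Ω' : Type*} [MeasurableSpace Ω'] {P : Measure Ω'} {Y : ℝ≥0 → Ω' → ZLattice d}

/-- The real-valued holding times of a path. -/
noncomputable def holdingTime {V : Type*} (y : ℝ≥0 → V) (n : ℕ) : ℝ :=
  (jumpTime y (n + 1) - jumpTime y n).toReal

/-- The sequence of the jumps and of the normalized holding times of a path. -/
noncomputable def drivingSequence (β : ℝ) (ω : Env d) (y : ℝ≥0 → ZLattice d) (n : ℕ) :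
    ZLattice d × ℝ :=
  (skeleton y (n + 1) - skeleton y n, jumpRate β ω (skeleton y n) * holdingTime y n)

theorem measurable_drivingSequence (hm : ∀ t, Measurable (Y t))
    (hr : ∀ a t, ∀ᶠ s in 𝓝[>] t, Y s a = Y t a) :
    Measurable fun a => drivingSequence β ω (Y · a) := by
  refine measurable_pi_lambda _ fun n => Measurable.prodMk ?_ ?_
  · exact (measurable_skeleton hm hr (n + 1)).sub (measurable_skeleton hm hr n)
  · have h1 : Measurable fun a => jumpRate β ω (skeleton (Y · a) n) :=
      (Measurable.of_discrete (f := jumpRate β ω)).comp (measurable_skeleton hm hr n)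
    have h2 : Measurable fun a => holdingTime (Y · a) n :=
      ((measurable_jumpTime hm hr (n + 1)).sub (measurable_jumpTime hm hr n)).ennreal_toReal
    exact h1.mul h2

theorem skeleton_eq_sum_iff {y : ℝ≥0 → ZLattice d} (h0 : skeleton y 0 = 0) (n : ℕ)
    (e : ℕ → ZLattice d) : (∀ i ≤ n, skeleton y i = ∑ j ∈ Finset.range i, e j) ↔
      ∀ i < n, skeleton y (i + 1) - skeleton y i = e i := by
  constructor
  · intro h i hi
    rw [h (i + 1) hi, h i hi.le, Finset.sum_range_succ, add_sub_cancel_left]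
  · intro h i
    induction i with
    | zero => intro _; simpa using h0
    | succ i ih =>
      intro hi
      rw [Finset.sum_range_succ, ← ih (Nat.le_of_succ_le hi), ← h i hi]
      abel

/-- The joint law of the first jumps and holding times. -/
theorem IsMarkovChainWithGenerator.law_steps (hd : 1 ≤ d)
    (h : IsMarkovChainWithGenerator (walkGenerator l lam β ω) 0 Y P) (n : ℕ) (e : ℕ → ZLattice d)
    (he : ∀ i < n, e i ∈ steps d) (u : ℕ → ℝ≥0) :
    P.real {a | jumpTime (Y · a) n < ⊤ ∧
        (∀ i ≤ n, skeleton (Y · a) i = ∑ j ∈ Finset.range i, e j) ∧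
        (∀ i < n, (u i : ℝ≥0∞) < jumpTime (Y · a) (i + 1) - jumpTime (Y · a) i)} =
      ∏ i ∈ Finset.range n, stepProb l lam (e i) *
        Real.exp (-(jumpRate β ω (∑ j ∈ Finset.range i, e j) * u i)) := by
  rw [h.law n (fun i => ∑ j ∈ Finset.range i, e j) u (by simp) fun i hi => by
    simpa [Finset.sum_range_succ] using ne_zero_of_mem_steps (he i hi)]
  refine Finset.prod_congr rfl fun i hi => ?_
  have hr : jumpRate β ω (∑ j ∈ Finset.range i, e j) ≠ 0 := (Real.exp_pos _).ne'
  rw [Finset.sum_range_succ, qMatrix_walkGenerator_of_ne l lam β ω _ (he i (Finset.mem_range.1 hi)),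
    qMatrix_walkGenerator_self l lam hd, neg_neg, mul_div_cancel_right₀ _ hr, neg_mul]

theorem measurableSet_law_event (hm : ∀ t, Measurable (Y t))
    (hr : ∀ a t, ∀ᶠ s in 𝓝[>] t, Y s a = Y t a) (n : ℕ) (x : ℕ → ZLattice d) (u : ℕ → ℝ≥0) :
    MeasurableSet {a | jumpTime (Y · a) n < ⊤ ∧ (∀ i ≤ n, skeleton (Y · a) i = x i) ∧
        (∀ i < n, (u i : ℝ≥0∞) < jumpTime (Y · a) (i + 1) - jumpTime (Y · a) i)} := by
  have hj := measurable_jumpTime hm hr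
  have hs := measurable_skeleton hm hr
  have e : {a | jumpTime (Y · a) n < ⊤ ∧ (∀ i ≤ n, skeleton (Y · a) i = x i) ∧
        (∀ i < n, (u i : ℝ≥0∞) < jumpTime (Y · a) (i + 1) - jumpTime (Y · a) i)}
      = {a | jumpTime (Y · a) n < ⊤} ∩ ((⋂ i, ⋂ _ : i ≤ n, {a | skeleton (Y · a) i = x i}) ∩
        ⋂ i, ⋂ _ : i < n,
          {a | (u i : ℝ≥0∞) < jumpTime (Y · a) (i + 1) - jumpTime (Y · a) i}) := by
    ext a
    simp only [Set.mem_inter_iff, Set.mem_iInter, Set.mem_ofPred_eq]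
  rw [e]
  refine (measurableSet_lt (hj n) measurable_const).inter (MeasurableSet.inter ?_ ?_)
  · exact MeasurableSet.iInter fun i => MeasurableSet.iInter fun _ =>
      hs i (measurableSet_singleton (x i))
  · exact MeasurableSet.iInter fun i => MeasurableSet.iInter fun _ =>
      measurableSet_lt measurable_const ((hj (i + 1)).sub (hj i))

theorem IsMarkovChainWithGenerator.ae_skeleton_zero {L : (ZLattice d → ℝ) → ZLattice d → ℝ}
    (h : IsMarkovChainWithGenerator L 0 Y P) :
    ∀ᵐ a ∂P, skeleton (Y · a) 0 = 0 := by
  filter_upwards [h.start] with a ha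
  simpa [skeleton, jumpTime] using ha

/-- With all time thresholds equal to 0, the probabilities of the admissible sequences of `n` steps
are products of step probabilities, and these sum to 1. -/
theorem IsMarkovChainWithGenerator.ae_jumpTime_lt_top (hd : 1 ≤ d)
    (h : IsMarkovChainWithGenerator (walkGenerator l lam β ω) 0 Y P) :
    ∀ᵐ a ∂P, ∀ n, jumpTime (Y · a) n < ⊤ ∧
      ∀ i < n, skeleton (Y · a) (i + 1) - skeleton (Y · a) i ∈ steps d := by
  have hP := h.isProbabilityMeasure
  rw [ae_all_iff]
  intro n
  let ext : (Fin n → ZLattice d) → ℕ → ZLattice d := fun e i => if hi : i < n then e ⟨i, hi⟩ else 0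
  have hext : ∀ e (i : Fin n), ext e i = e i := fun e i => by simp [ext]
  let A : (Fin n → ZLattice d) → Set Ω' := fun e => {a | jumpTime (Y · a) n < ⊤ ∧
        (∀ i ≤ n, skeleton (Y · a) i = ∑ j ∈ Finset.range i, ext e j) ∧
        (∀ i < n, ((0 : ℝ≥0) : ℝ≥0∞) < jumpTime (Y · a) (i + 1) - jumpTime (Y · a) i)}
  have hA : ∀ e, MeasurableSet (A e) := fun e =>
    measurableSet_law_event h.measurable h.right_continuous n _ fun _ => 0
  have hAs : ∀ e, ∀ a ∈ A e, ∀ i : Fin n,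
      skeleton (Y · a) (i + 1) - skeleton (Y · a) i = e i := by
    rintro e a ⟨-, ha, -⟩ i
    rw [ha _ i.2, ha _ i.2.le, Finset.sum_range_succ, add_sub_cancel_left, hext]
  have hsum : P.real (⋃ e ∈ Fintype.piFinset fun _ : Fin n => steps d, A e) = 1 := by
    rw [measureReal_biUnion_finset]
    · have : ∀ e ∈ Fintype.piFinset fun _ : Fin n => steps d,
          P.real (A e) = ∏ i : Fin n, stepProb l lam (e i) := by
        intro e he
        rw [Fintype.mem_piFinset] at he
        have := h.law_steps hd n (ext e) (fun i hi => by simpa [ext, hi] using he ⟨i, hi⟩)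
          fun _ => 0
        rw [this, Finset.prod_range]
        simp [hext]
      rw [Finset.sum_congr rfl this, ← Finset.prod_univ_sum (fun _ => steps d)
        fun _ e => stepProb l lam e]
      simp [sum_stepProb l lam hd]
    · intro e _ e' _ hne
      rw [Function.onFun, Set.disjoint_left]
      intro a ha ha'
      exact hne (funext fun i => (hAs e a ha i).symm.trans (hAs e' a ha' i))
    · exact fun e _ => hA e
  have hae : ∀ᵐ a ∂P, a ∈ ⋃ e ∈ Fintype.piFinset fun _ : Fin n => steps d, A e := by
    refine (mem_ae_iff_prob_eq_one (Finset.measurableSet_biUnion _ fun e _ => hA e)).2 ?_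
    rw [← ofReal_measureReal (measure_ne_top _ _), hsum, ENNReal.ofReal_one]
  filter_upwards [hae] with a ha
  obtain ⟨e, he, ha⟩ := Set.mem_iUnion₂.1 ha
  refine ⟨ha.1, fun i hi => ?_⟩
  rw [hAs e a ha ⟨i, hi⟩]
  exact Fintype.mem_piFinset.1 he _

end DrivingSequence

/-! ### The driving sequence is i.i.d. -/

section DrivingLaw

variable {d : ℕ} {l : EuclideanSpace ℝ (Fin d)} {lam β : ℝ} {ω : Env d}
  {Ω' : Type*} [MeasurableSpace Ω'] {P : Measure Ω'} {Y : ℝ≥0 → Ω' → ZLattice d}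

/-- Thresholds in the law of the chain are nonnegative; clipping `v` at 0 loses nothing because the
holding time is positive. -/
theorem lt_mul_toReal_iff {r v : ℝ} (hr : 0 < r) {τ : ℝ≥0∞} (h0 : 0 < τ) (hτ : τ ≠ ⊤) :
    v < r * τ.toReal ↔ ((max v 0 / r).toNNReal : ℝ≥0∞) < τ := by
  have hpos : 0 < τ.toReal := ENNReal.toReal_pos h0.ne' hτ
  change _ ↔ ENNReal.ofReal (max v 0 / r) < τ
  rw [ENNReal.ofReal_lt_iff_lt_toReal (by positivity) hτ, div_lt_iff₀' hr, max_lt_iff]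
  exact ⟨fun h => ⟨h, by positivity⟩, fun h => h.1⟩

/-- Taking as time threshold the clipped `v i` divided by the rate at the `i`-th site cancels the
rate in the exponential, so the environment drops out. -/
theorem IsMarkovChainWithGenerator.measure_drivingSequence_box (hd : 1 ≤ d)
    (h : IsMarkovChainWithGenerator (walkGenerator l lam β ω) 0 Y P) (n : ℕ) (e : ℕ → ZLattice d)
    (v : ℕ → ℝ) :
    P {a | ∀ i < n, drivingSequence β ω (Y · a) i ∈ ({e i} : Set (ZLattice d)) ×ˢ Set.Ioi (v i)}
      = ∏ i ∈ Finset.range n, driveMeasure l lam ({e i} ×ˢ Set.Ioi (v i)) := by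
  have hP := h.isProbabilityMeasure
  by_cases he : ∀ i < n, e i ∈ steps d
  · let u : ℕ → ℝ≥0 := fun i =>
      (max (v i) 0 / jumpRate β ω (∑ j ∈ Finset.range i, e j)).toNNReal
    have huv : ∀ i, u i = (max (v i) 0 / jumpRate β ω (∑ j ∈ Finset.range i, e j)).toNNReal :=
      fun _ => rfl
    have hrate : ∀ x, 0 < jumpRate β ω x := fun x => Real.exp_pos _
    have hae : {a | ∀ i < n, drivingSequence β ω (Y · a) i
          ∈ ({e i} : Set (ZLattice d)) ×ˢ Set.Ioi (v i)}
        =ᵐ[P] {a | jumpTime (Y · a) n < ⊤ ∧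
        (∀ i ≤ n, skeleton (Y · a) i = ∑ j ∈ Finset.range i, e j) ∧
        (∀ i < n, (u i : ℝ≥0∞) < jumpTime (Y · a) (i + 1) - jumpTime (Y · a) i)} := by
      rw [eventuallyEq_set]
      filter_upwards [h.ae_jumpTime_lt_top hd, h.ae_skeleton_zero] with a ha ha0
      have hτ : ∀ i, jumpTime (Y · a) (i + 1) - jumpTime (Y · a) i ≠ ⊤ := fun i =>
        (tsub_le_self.trans_lt (ha (i + 1)).1).ne
      have hτ0 : ∀ i, 0 < jumpTime (Y · a) (i + 1) - jumpTime (Y · a) i := fun i =>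
        tsub_pos_of_lt (jumpTime_lt_succ (h.right_continuous a) (ha i).1)
      change (∀ i < n, _) ↔ (_ ∧ (∀ i ≤ n, _) ∧ ∀ i < n, _)
      rw [skeleton_eq_sum_iff ha0]
      constructor
      · intro H
        have hx : ∀ i < n, skeleton (Y · a) (i + 1) - skeleton (Y · a) i = e i :=
          fun i hi => (H i hi).1
        refine ⟨(ha n).1, hx, fun i hi => ?_⟩
        rw [huv, ← (skeleton_eq_sum_iff ha0 n e).2 hx i hi.le,
          ← lt_mul_toReal_iff (hrate _) (hτ0 i) (hτ i)]
        exact (H i hi).2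
      · rintro ⟨-, hx, H⟩ i hi
        refine ⟨hx i hi, ?_⟩
        have := H i hi
        rw [huv, ← (skeleton_eq_sum_iff ha0 n e).2 hx i hi.le,
          ← lt_mul_toReal_iff (hrate _) (hτ0 i) (hτ i)] at this
        exact this
    rw [measure_congr hae, ← ofReal_measureReal (measure_ne_top _ _), h.law_steps hd n e he u,
      ENNReal.ofReal_prod_of_nonneg fun i _ =>
        mul_nonneg (stepProb_pos l lam hd _).le (Real.exp_pos _).le]
    refine Finset.prod_congr rfl fun i hi => ?_
    rw [driveMeasure_singleton_prod_Ioi l lam hd (he i (Finset.mem_range.1 hi)), huv,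
      Real.coe_toNNReal _ (div_nonneg (le_max_right _ _) (hrate _).le),
      mul_div_cancel₀ _ (hrate _).ne']
  -- If some `e k` is not a neighbour of the origin, both sides vanish.
  · push Not at he
    obtain ⟨k, hk, hek⟩ := he
    rw [Finset.prod_eq_zero (Finset.mem_range.2 hk)
      (driveMeasure_singleton_prod_of_notMem l lam hek _)]
    refine measure_mono_null (fun a ha => ?_) (h.ae_jumpTime_lt_top hd)
    intro H
    have h1 := (H n).2 k hk
    have h2 : skeleton (Y · a) (k + 1) - skeleton (Y · a) k = e k := (ha k hk).1
    exact hek (h2 ▸ h1)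

theorem isPiSystem_range_singleton {α : Type*} : IsPiSystem (Set.range fun x : α => ({x} : Set α)) := by
  rintro _ ⟨x, rfl⟩ _ ⟨y, rfl⟩ ⟨z, hz1, hz2⟩
  have h1 : z = x := hz1
  have h2 : z = y := hz2
  subst h1 h2
  exact ⟨z, by simp⟩

theorem generateFrom_range_singleton {α : Type*} [MeasurableSpace α] [Countable α]
    [MeasurableSingletonClass α] :
    MeasurableSpace.generateFrom (Set.range fun x : α => ({x} : Set α)) = ‹MeasurableSpace α› := by
  refine le_antisymm (MeasurableSpace.generateFrom_le ?_) fun s _ => ?_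
  · rintro _ ⟨x, rfl⟩
    exact measurableSet_singleton x
  · rw [← Set.biUnion_of_singleton s]
    exact MeasurableSet.biUnion s.to_countable fun x _ =>
      MeasurableSpace.measurableSet_generateFrom ⟨x, rfl⟩

/-- The driving sequence is i.i.d., whatever the environment. -/
theorem IsMarkovChainWithGenerator.map_drivingSequence (hd : 1 ≤ d)
    [IsProbabilityMeasure (driveMeasure l lam)]
    (h : IsMarkovChainWithGenerator (walkGenerator l lam β ω) 0 Y P) :
    P.map (fun a => drivingSequence β ω (Y · a))
      = Measure.infinitePi fun _ : ℕ => driveMeasure l lam := by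
  have hP := h.isProbabilityMeasure
  have hm := measurable_drivingSequence (β := β) (ω := ω) h.measurable h.right_continuous
  have := isProbabilityMeasure_expMeasure one_pos
  have := isProbabilityMeasure_stepMeasure l lam hd
  have hIoi : MeasurableSpace.generateFrom (Set.range (Set.Ioi : ℝ → Set ℝ))
      = (inferInstance : MeasurableSpace ℝ) := by
    rw [← borel_eq_generateFrom_Ioi, BorelSpace.measurable_eq (α := ℝ)]
  obtain ⟨q, hq⟩ := exists_surjective_nat (ZLattice d)
  let S1 : (stepMeasure l lam).FiniteSpanningSetsIn (Set.range fun x : ZLattice d => {x}) :=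
    ⟨fun n => {q n}, fun n => ⟨q n, rfl⟩, fun n => measure_lt_top _ _, by
      ext x
      obtain ⟨n, rfl⟩ := hq x
      simp only [Set.mem_iUnion, Set.mem_univ, iff_true]
      exact ⟨n, rfl⟩⟩
  let S2 : (expMeasure 1).FiniteSpanningSetsIn (Set.range (Set.Ioi : ℝ → Set ℝ)) :=
    ⟨fun n => Set.Ioi (-(n : ℝ)), fun n => ⟨_, rfl⟩, fun n => measure_lt_top _ _, by
      ext x
      obtain ⟨n, hn⟩ := exists_nat_gt (-x)
      simp only [Set.mem_iUnion, Set.mem_univ, iff_true]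
      exact ⟨n, by rw [Set.mem_Ioi]; linarith⟩⟩
  have hmn : ∀ n : ℕ, Measurable fun a (i : Fin n) => drivingSequence β ω (Y · a) i :=
    fun n => measurable_pi_lambda _ fun i => (measurable_pi_apply (i : ℕ)).comp hm
  -- The boxes `{e} ×ˢ Set.Ioi v` form a generating π-system with countable covers, so they
  -- determine the finite-dimensional laws.
  have hpi : ∀ n : ℕ, Measure.pi (fun _ : Fin n => driveMeasure l lam)
      = P.map fun a (i : Fin n) => drivingSequence β ω (Y · a) i := by
    intro n
    refine Measure.pi_eq_generateFrom
      (C := fun _ => Set.image2 (· ×ˢ ·) (Set.range fun x : ZLattice d => ({x} : Set (ZLattice d)))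
        (Set.range (Set.Ioi : ℝ → Set ℝ)))
      (fun _ => generateFrom_eq_prod generateFrom_range_singleton hIoi
        S1.isCountablySpanning S2.isCountablySpanning)
      (fun _ => isPiSystem_range_singleton.prod isPiSystem_Ioi) (fun _ => S1.prod S2) ?_
    intro s hs
    have hs' : ∀ i, ∃ (e : ZLattice d) (v : ℝ), s i = {e} ×ˢ Set.Ioi v := by
      intro i
      obtain ⟨_, ⟨e, rfl⟩, _, ⟨v, rfl⟩, hi⟩ := hs i
      exact ⟨e, v, hi.symm⟩
    choose e v hev using hs'
    have hbox := h.measure_drivingSequence_box hd n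
      (fun i => if hi : i < n then e ⟨i, hi⟩ else 0) fun i => if hi : i < n then v ⟨i, hi⟩ else 0
    rw [Measure.map_apply (hmn n) (MeasurableSet.univ_pi fun i => by
      rw [hev i]; exact (measurableSet_singleton _).prod measurableSet_Ioi)]
    rw [Finset.prod_range] at hbox
    convert hbox using 1
    · congr 1
      ext a
      simp only [Set.mem_preimage, Set.mem_pi, Set.mem_univ, true_imp_iff, Set.mem_ofPred_eq]
      constructor
      · intro H i hi
        have := H ⟨i, hi⟩
        rw [hev] at this
        simpa [hi] using this
      · intro H i
        have := H i i.2
        rw [hev]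
        simpa using this
    · refine Finset.prod_congr rfl fun i _ => ?_
      rw [hev]
      simp [driveMeasure]
  refine eq_infinitePi_of_pi_range fun n t ht => ?_
  have := congrArg (fun μ => μ (Set.univ.pi fun i : Fin n => t i)) (hpi n)
  simp only [Measure.pi_pi] at this
  rw [Finset.prod_range, this, Measure.map_apply hm (measurableSet_pi_range ht n),
    Measure.map_apply (hmn n) (MeasurableSet.univ_pi fun i => ht i)]
  congr 1
  ext a
  simp only [Set.mem_preimage, Set.mem_pi, Set.mem_univ, true_imp_iff, Finset.mem_coe,
    Finset.mem_range]
  exact ⟨fun H i => H i i.2, fun H i hi => H ⟨i, hi⟩⟩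

end DrivingLaw

/-! ### From the jump chain to continuous time -/

section TimeChange

/-- Let `N t` be an index with `s (N t) ≤ t < s (N t + 1)`. Both ends are asymptotic to `m * N t`,
hence so is `t`, and the Lipschitz bound makes `G t - G (s (N t))` negligible against `N t`. -/
theorem tendsto_div_of_tendsto_jump {s : ℕ → ℝ} (hmono : Monotone s) (h0 : s 0 = 0) {m : ℝ}
    (hm : 0 < m) (hs : Tendsto (fun n : ℕ => s n / n) atTop (𝓝 m)) {G : ℝ → ℝ} {C : ℝ}
    (hG : ∀ u v, 0 ≤ u → u ≤ v → |G v - G u| ≤ C * (v - u)) {L : ℝ}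
    (hL : Tendsto (fun n : ℕ => G (s n) / n) atTop (𝓝 L)) :
    Tendsto (fun t => G t / t) atTop (𝓝 (L / m)) := by
  have hcast : Tendsto (fun n : ℕ => (n : ℝ)) atTop atTop := tendsto_natCast_atTop_atTop
  have hs_top : Tendsto s atTop atTop := by
    have := hs.pos_mul_atTop hm hcast
    refine this.congr' ?_
    filter_upwards [eventually_gt_atTop 0] with n hn
    have : (n : ℝ) ≠ 0 := by exact_mod_cast hn.ne'
    field_simp
  have hex : ∀ t : ℝ, ∃ N : ℕ, 0 ≤ t → s N ≤ t ∧ t < s (N + 1) := by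
    intro t
    by_cases ht : 0 ≤ t
    · have hex' : ∃ k, t < s k := (hs_top.eventually_gt_atTop t).exists
      classical
      obtain ⟨k, hk⟩ : ∃ k, Nat.find hex' = k + 1 := by
        refine Nat.exists_eq_succ_of_ne_zero fun h => ?_
        have := Nat.find_spec hex'
        rw [h, h0] at this
        exact this.not_ge ht
      refine ⟨k, fun _ => ⟨?_, ?_⟩⟩
      · exact not_lt.1 (Nat.find_min hex' (by omega))
      · rw [← hk]; exact Nat.find_spec hex'
    · exact ⟨0, fun h => absurd h ht⟩
  choose N hN using hex
  have hN_top : Tendsto N atTop atTop := by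
    refine tendsto_atTop.2 fun K => ?_
    filter_upwards [eventually_ge_atTop (s K), eventually_ge_atTop 0] with t ht ht0
    by_contra! hlt
    exact ((hN t ht0).2.trans_le (hmono (Nat.succ_le_of_lt hlt))).not_ge ht
  have hs' : Tendsto (fun n : ℕ => s (n + 1) / n) atTop (𝓝 m) := by
    have h1 : Tendsto (fun n : ℕ => s (n + 1) / ((n + 1 : ℕ) : ℝ)) atTop (𝓝 m) :=
      hs.comp (tendsto_add_atTop_nat 1)
    have h2 : Tendsto (fun n : ℕ => ((n + 1 : ℕ) : ℝ) / n) atTop (𝓝 1) := by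
      have h3 : Tendsto (fun n : ℕ => 1 + (1 : ℝ) / n) atTop (𝓝 (1 + 0)) :=
        tendsto_const_nhds.add tendsto_one_div_atTop_nhds_zero_nat
      rw [add_zero] at h3
      refine h3.congr' ?_
      filter_upwards [eventually_gt_atTop 0] with n hn
      have : (n : ℝ) ≠ 0 := by exact_mod_cast hn.ne'
      push_cast
      field_simp
    have h4 := h1.mul h2
    rw [mul_one] at h4
    refine h4.congr fun n => ?_
    have : ((n + 1 : ℕ) : ℝ) ≠ 0 := by positivity
    field_simp
  have hlow : Tendsto (fun t => s (N t) / N t) atTop (𝓝 m) := hs.comp hN_top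
  have hup : Tendsto (fun t => s (N t + 1) / N t) atTop (𝓝 m) := hs'.comp hN_top
  have htN : Tendsto (fun t => t / N t) atTop (𝓝 m) := by
    refine tendsto_of_tendsto_of_tendsto_of_le_of_le' hlow hup ?_ ?_
    · filter_upwards [eventually_ge_atTop 0] with t ht
      exact div_le_div_of_nonneg_right (hN t ht).1 (Nat.cast_nonneg _)
    · filter_upwards [eventually_ge_atTop 0] with t ht
      exact div_le_div_of_nonneg_right (hN t ht).2.le (Nat.cast_nonneg _)
  have hGN : Tendsto (fun t => G t / N t) atTop (𝓝 L) := by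
    have h1 : Tendsto (fun t => C * (t / N t - s (N t) / N t)) atTop (𝓝 0) := by
      simpa using (htN.sub hlow).const_mul C
    have h2 : Tendsto (fun t => G t / N t - G (s (N t)) / N t) atTop (𝓝 0) := by
      refine squeeze_zero_norm' ?_ h1
      filter_upwards [eventually_ge_atTop 0] with t ht
      rw [← sub_div, ← sub_div, Real.norm_eq_abs, abs_div, Nat.abs_cast, ← mul_div_assoc]
      refine div_le_div_of_nonneg_right (hG _ _ ?_ (hN t ht).1) (Nat.cast_nonneg _)
      rw [← h0]; exact hmono (Nat.zero_le _)
    have h3 : Tendsto (fun t => G (s (N t)) / N t) atTop (𝓝 L) := hL.comp hN_top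
    simpa using h2.add h3
  refine (hGN.div htN hm.ne').congr' ?_
  filter_upwards [hN_top.eventually_gt_atTop 0] with t ht
  have : (N t : ℝ) ≠ 0 := by exact_mod_cast ht.ne'
  simp only [Pi.div_apply]
  rw [div_div_div_cancel_right₀ this]

theorem jumpTime_toReal_eq_sum {V : Type*} {y : ℝ≥0 → V} (hfin : ∀ n, jumpTime y n < ⊤) (n : ℕ) :
    (jumpTime y n).toReal = ∑ i ∈ Finset.range n, holdingTime y i := by
  induction n with
  | zero => simp [jumpTime]
  | succ n ih =>
    rw [Finset.sum_range_succ, ← ih, holdingTime,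
      ENNReal.toReal_sub_of_le (jumpTime_le_succ n) (hfin (n + 1)).ne]
    ring

theorem monotone_jumpTime_toReal {V : Type*} {y : ℝ≥0 → V} (hfin : ∀ n, jumpTime y n < ⊤) :
    Monotone fun n => (jumpTime y n).toReal :=
  monotone_nat_of_le_succ fun n => ENNReal.toReal_mono (hfin (n + 1)).ne (jumpTime_le_succ n)

theorem intervalIntegrable_path {V : Type*} [MeasurableSpace V] [Countable V]
    [MeasurableSingletonClass V] {y : ℝ≥0 → V} (hy : ∀ t, ∀ᶠ s in 𝓝[>] t, y s = y t)
    {g : V → ℝ} {C : ℝ} (hg : ∀ v, |g v| ≤ C) (a b : ℝ) :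
    IntervalIntegrable (fun s => g (y s.toNNReal)) volume a b := by
  have hm : Measurable fun s : ℝ => g (y s.toNNReal) :=
    (Measurable.of_discrete (f := g)).comp
      ((measurable_of_right_continuous hy).comp measurable_real_toNNReal)
  exact (intervalIntegrable_const (c := C)).mono_fun hm.aestronglyMeasurable
    (ae_of_all _ fun s => (hg _).trans (le_abs_self C))

/-- The integral of a function along a path up to a jump time. -/
theorem integral_path_jumpTime {V : Type*} [MeasurableSpace V] [Countable V]
    [MeasurableSingletonClass V] {y : ℝ≥0 → V} (hy : ∀ t, ∀ᶠ s in 𝓝[>] t, y s = y t)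
    (hfin : ∀ n, jumpTime y n < ⊤) {g : V → ℝ} {C : ℝ} (hg : ∀ v, |g v| ≤ C) (n : ℕ) :
    ∫ s in (0 : ℝ)..(jumpTime y n).toReal, g (y s.toNNReal)
      = ∑ i ∈ Finset.range n, holdingTime y i * g (skeleton y i) := by
  have h := intervalIntegral.sum_integral_adjacent_intervals (f := fun s => g (y s.toNNReal))
    (μ := volume) (a := fun n => (jumpTime y n).toReal) (n := n)
    fun k _ => intervalIntegrable_path hy hg _ _
  have h0 : (jumpTime y 0).toReal = 0 := by simp [jumpTime]
  rw [h0] at h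
  rw [← h]
  refine Finset.sum_congr rfl fun i _ => ?_
  rw [intervalIntegral.integral_congr_Ioo_of_le (g := fun _ => g (skeleton y i))
    (monotone_jumpTime_toReal hfin (Nat.le_succ i)), intervalIntegral.integral_const,
    smul_eq_mul, holdingTime, ENNReal.toReal_sub_of_le (jumpTime_le_succ i) (hfin (i + 1)).ne]
  intro s hs
  have hs0 : 0 ≤ s := ENNReal.toReal_nonneg.trans hs.1.le
  have e : ((s.toNNReal : ℝ≥0) : ℝ≥0∞) = ENNReal.ofReal s := rfl
  change g _ = g _
  rw [eq_skeleton_of_mem (y := y) (n := i)]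
  · rw [e]; exact (ENNReal.le_ofReal_iff_toReal_le (hfin i).ne hs0).2 hs.1.le
  · rw [e]; exact (ENNReal.ofReal_lt_iff_lt_toReal hs0 (hfin (i + 1)).ne).2 hs.2

/-- If the averages of `g` along the jump chain, weighted by the holding times, converge, so does
the time average. -/
theorem tendsto_time_average {V : Type*} [MeasurableSpace V] [Countable V]
    [MeasurableSingletonClass V] {y : ℝ≥0 → V} (hy : ∀ t, ∀ᶠ s in 𝓝[>] t, y s = y t)
    (hfin : ∀ n, jumpTime y n < ⊤) {g : V → ℝ} {C : ℝ} (hg : ∀ v, |g v| ≤ C) {m L : ℝ}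
    (hm : 0 < m)
    (h1 : Tendsto (fun n : ℕ => (∑ i ∈ Finset.range n, holdingTime y i) / n) atTop (𝓝 m))
    (hL : Tendsto (fun n : ℕ => (∑ i ∈ Finset.range n, holdingTime y i * g (skeleton y i)) / n)
      atTop (𝓝 L)) :
    Tendsto (fun t => (∫ s in (0 : ℝ)..t, g (y s.toNNReal)) / t) atTop (𝓝 (L / m)) := by
  refine tendsto_div_of_tendsto_jump (C := C) (monotone_jumpTime_toReal hfin) (by simp [jumpTime])
    hm (by simpa only [jumpTime_toReal_eq_sum hfin] using h1) (fun u v _ huv => ?_)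
    (by simpa only [integral_path_jumpTime hy hfin hg] using hL)
  rw [intervalIntegral.integral_interval_sub_left (intervalIntegrable_path hy hg _ _)
    (intervalIntegrable_path hy hg _ _)]
  have := intervalIntegral.norm_integral_le_of_norm_le_const (a := u) (b := v)
    (f := fun s => g (y s.toNNReal)) (C := C) fun s _ => hg _
  rwa [abs_of_nonneg (sub_nonneg.2 huv)] at this

end TimeChange

/-! ### The environment seen from the walker -/

section Environment

variable {d : ℕ}

/-- The action of a step (with its normalized holding time) on the environment. -/
def stepShift (e : ZLattice d × ℝ) (ω : Env d) : Env d := shift e.1 ω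

theorem measurable_uncurry_stepShift :
    Measurable (Function.uncurry (stepShift : ZLattice d × ℝ → Env d → Env d)) := by
  have h : Measurable fun z : ZLattice d × Env d => shift z.1 z.2 :=
    measurable_from_prod_countable_right fun x => measurable_shift x
  exact h.comp ((measurable_fst.comp measurable_fst).prodMk measurable_snd)

theorem skewShift_stepShift_iterate (n : ℕ) (ω : Env d) (η : ℕ → ZLattice d × ℝ) :
    (skewShift stepShift)^[n] (ω, η)
      = (shift (∑ j ∈ Finset.range n, (η j).1) ω, fun k => η (k + n)) := by
  induction n with
  | zero => simp
  | succ n ih =>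
    rw [Function.iterate_succ_apply', ih, skewShift, stepShift, shift_shift,
      Finset.sum_range_succ]
    simp [add_right_comm, add_assoc]

/-- One step of positive probability with an ergodic shift is enough; the first unit vector serves.
-/
theorem ergodic_environment (p : unitInterval) (l : EuclideanSpace ℝ (Fin d)) (lam : ℝ)
    (hd : 1 ≤ d) [IsProbabilityMeasure (driveMeasure l lam)] :
    Ergodic (skewShift stepShift)
      ((percolation d p).prod (Measure.infinitePi fun _ : ℕ => driveMeasure l lam)) := by
  refine ergodic_skewShift measurable_uncurry_stepShift
    (fun e => measurePreserving_shift p e.1)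
    (D := {Pi.single ⟨0, hd⟩ 1} ×ˢ Set.Ioi 0) ?_ ?_
  · rw [driveMeasure_singleton_prod_Ioi l lam hd (single_mem_steps hd)]
    exact (ENNReal.ofReal_pos.2 (mul_pos (stepProb_pos l lam hd _) (Real.exp_pos _))).ne'
  · rintro ⟨e, v⟩ he
    have he' : e = Pi.single ⟨0, hd⟩ 1 := he.1
    exact ergodic_shift p (he' ▸ ne_zero_of_mem_steps (single_mem_steps hd))

/-- The ergodic theorem for the environment at the jump times, weighted by the holding times. -/
theorem ae_tendsto_weighted_average {p : unitInterval} (l : EuclideanSpace ℝ (Fin d)) (lam : ℝ)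
    {β : ℝ} (hd : 1 ≤ d) [IsProbabilityMeasure (driveMeasure l lam)]
    (hint : Integrable (fun ω => Real.exp (β * clusterCard ω 0)) (percolation d p))
    {f : Env d → ℝ} (hf : Measurable f) {C : ℝ} (hC : ∀ ω, |f ω| ≤ C) :
    ∀ᵐ ω ∂(percolation d p), ∀ᵐ η ∂(Measure.infinitePi fun _ : ℕ => driveMeasure l lam),
      Tendsto (fun n : ℕ => (∑ i ∈ Finset.range n,
        (Real.exp (β * clusterCard ω (∑ j ∈ Finset.range i, (η j).1))
          * f (shift (∑ j ∈ Finset.range i, (η j).1) ω)) * (η i).2) / n) atTop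
        (𝓝 (∫ ω, Real.exp (β * clusterCard ω 0) * f ω ∂(percolation d p))) := by
  have := isProbabilityMeasure_expMeasure one_pos
  have := isProbabilityMeasure_stepMeasure l lam hd
  have hg : Measurable fun ω : Env d => Real.exp (β * clusterCard ω 0) * f ω :=
    (Real.measurable_exp.comp ((measurable_clusterCard 0).const_mul β)).mul hf
  have hgi : Integrable (fun ω : Env d => Real.exp (β * clusterCard ω 0) * f ω)
      (percolation d p) := hint.mul_bdd (c := C) hf.aestronglyMeasurable (ae_of_all _ hC)
  have hmp := measurePreserving_eval_infinitePi (fun _ : ℕ => driveMeasure l lam) 0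
  have h2i : Integrable (fun e : ZLattice d × ℝ => e.2) (driveMeasure l lam) :=
    integrable_id_expMeasure.comp_snd _
  have hηi : Integrable (fun η : ℕ → ZLattice d × ℝ => (η 0).2)
      (Measure.infinitePi fun _ : ℕ => driveMeasure l lam) := hmp.integrable_comp_of_integrable h2i
  have hη1 : ∫ η : ℕ → ZLattice d × ℝ, (η 0).2
      ∂(Measure.infinitePi fun _ : ℕ => driveMeasure l lam) = 1 := by
    have h1 := integral_map hmp.aemeasurable (f := fun e : ZLattice d × ℝ => e.2)
      measurable_snd.aestronglyMeasurable
    rw [hmp.map_eq] at h1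
    simp only [Function.eval] at h1
    have h2 : ∫ e : ZLattice d × ℝ, e.2 ∂(driveMeasure l lam) = 1 := by
      rw [driveMeasure, integral_fun_snd (f := fun x : ℝ => x), integral_id_expMeasure]
      simp
    rw [← h1, h2]
  have hη : Measurable fun z : Env d × (ℕ → ZLattice d × ℝ) => (z.2 0).2 :=
    ((measurable_pi_apply 0).comp measurable_snd).snd
  have hFm : Measurable fun z : Env d × (ℕ → ZLattice d × ℝ) =>
      (Real.exp (β * clusterCard z.1 0) * f z.1) * (z.2 0).2 := (hg.comp measurable_fst).mul hη
  -- The integrand is a product of functions of independent variables, so its integral factors, with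
  -- exponential mean 1.
  have hFi := hgi.mul_prod hηi
  have hbirk := tendsto_birkhoffSum_div (ergodic_environment p l lam hd) hFm hFi
  rw [integral_prod_mul (fun ω : Env d => Real.exp (β * clusterCard ω 0) * f ω)
    fun η : ℕ → ZLattice d × ℝ => (η 0).2, hη1, mul_one] at hbirk
  filter_upwards [Measure.ae_ae_of_ae_prod hbirk] with ω hω
  filter_upwards [hω] with η hη
  simpa only [birkhoffSum, skewShift_stepShift_iterate, clusterCard_shift, zero_add] using hη

theorem integral_empiricalMeasure (ω : Env d) {y : ℝ≥0 → ZLattice d}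
    (hy : ∀ t, ∀ᶠ s in 𝓝[>] t, y s = y t) (t : ℝ≥0) (f : Env d → ℝ) (hf : Measurable f) :
    ∫ a, f a ∂(empiricalMeasure ω y t)
      = (∫ s in (0 : ℝ)..t, f (shift (y s.toNNReal) ω)) / t := by
  have hm : Measurable fun s : ℝ => shift (y s.toNNReal) ω :=
    (Measurable.of_discrete (f := fun x => shift x ω)).comp
      ((measurable_of_right_continuous hy).comp measurable_real_toNNReal)
  rw [empiricalMeasure, integral_smul_measure, Measure.bind_dirac_eq_map _ hm,
    integral_map hm.aemeasurable hf.aestronglyMeasurable, intervalIntegral.integral_of_le (NNReal.coe_nonneg t),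
    integral_Icc_eq_integral_Ioc, ENNReal.toReal_inv, ENNReal.coe_toReal, smul_eq_mul,
    inv_mul_eq_div]

theorem isProbabilityMeasure_empiricalMeasure (ω : Env d) {y : ℝ≥0 → ZLattice d}
    (hy : ∀ t, ∀ᶠ s in 𝓝[>] t, y s = y t) {t : ℝ≥0} (ht : 0 < t) :
    IsProbabilityMeasure (empiricalMeasure ω y t) := by
  have hm : Measurable fun s : ℝ => shift (y s.toNNReal) ω :=
    (Measurable.of_discrete (f := fun x => shift x ω)).comp
      ((measurable_of_right_continuous hy).comp measurable_real_toNNReal)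
  constructor
  rw [empiricalMeasure, Measure.bind_dirac_eq_map _ hm, Measure.smul_apply,
    Measure.map_apply hm .univ, Set.preimage_univ, Measure.restrict_apply_univ, Real.volume_Icc,
    sub_zero, ENNReal.ofReal_coe_nnreal, smul_eq_mul,
    ENNReal.inv_mul_cancel (by exact_mod_cast ht.ne') ENNReal.coe_ne_top]

theorem integral_exp_clusterCard_pos {p : unitInterval} {β : ℝ}
    (hint : Integrable (fun ω => Real.exp (β * clusterCard ω 0)) (percolation d p)) :
    0 < ∫ ω, Real.exp (β * clusterCard ω 0) ∂(percolation d p) := integral_exp_pos hint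

theorem integral_limitMeasure {p : unitInterval} {β : ℝ}
    (hint : Integrable (fun ω => Real.exp (β * clusterCard ω 0)) (percolation d p))
    (f : Env d → ℝ) :
    ∫ ω, f ω ∂(limitMeasure d p β)
      = (∫ ω, Real.exp (β * clusterCard ω 0) * f ω ∂(percolation d p))
        / ∫ ω, Real.exp (β * clusterCard ω 0) ∂(percolation d p) := by
  have hpos := integral_exp_clusterCard_pos hint
  have hm : Measurable fun ω : Env d => Real.exp (β * clusterCard ω 0) :=
    Real.measurable_exp.comp ((measurable_clusterCard 0).const_mul β)
  rw [limitMeasure, integral_withDensity_eq_integral_toReal_smul (hm.div_const _).ennreal_ofReal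
    (ae_of_all _ fun _ => ENNReal.ofReal_lt_top), ← integral_div]
  refine integral_congr_ae (ae_of_all _ fun ω => ?_)
  simp only [smul_eq_mul]
  rw [ENNReal.toReal_ofReal (div_nonneg (Real.exp_pos _).le hpos.le)]
  ring

theorem isProbabilityMeasure_limitMeasure {p : unitInterval} {β : ℝ}
    (hint : Integrable (fun ω => Real.exp (β * clusterCard ω 0)) (percolation d p)) :
    IsProbabilityMeasure (limitMeasure d p β) := by
  have hpos := integral_exp_clusterCard_pos hint
  constructor
  rw [limitMeasure, withDensity_apply _ .univ, Measure.restrict_univ,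
    ← ofReal_integral_eq_lintegral_ofReal (hint.div_const _)
      (ae_of_all _ fun ω => div_nonneg (Real.exp_pos _).le hpos.le), integral_div,
    div_self hpos.ne', ENNReal.ofReal_one]

/-- On a compact metrizable space, weak convergence has to be checked on a dense sequence only. -/
theorem convergesWeakly_of_denseRange {E : Type*} [TopologicalSpace E] [CompactSpace E]
    [MeasurableSpace E] [BorelSpace E] {μ : ℝ≥0 → Measure E} {ν : Measure E}
    (hμ : ∀ t, 0 < t → IsProbabilityMeasure (μ t)) (hν : IsProbabilityMeasure ν)
    {F : ℕ → C(E, ℝ)} (hF : DenseRange F)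
    (h : ∀ k, Tendsto (fun t => ∫ a, F k a ∂(μ t)) atTop (𝓝 (∫ a, F k a ∂ν))) :
    ConvergesWeakly μ ν := by
  refine ⟨hμ, hν, fun f => ?_⟩
  have hfF : ∀ (ρ : Measure E), IsProbabilityMeasure ρ → ∀ k ε, dist f.toContinuousMap (F k) < ε →
      |∫ a, f a ∂ρ - ∫ a, F k a ∂ρ| ≤ ε := by
    intro ρ hρ k ε hk
    have i1 : Integrable (fun a => f a) ρ := f.integrable ρ
    have i2 : Integrable (fun a => F k a) ρ :=
      (BoundedContinuousFunction.mkOfCompact (F k)).integrable ρ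
    rw [← integral_sub i1 i2, ← Real.norm_eq_abs]
    have := norm_integral_le_of_norm_le_const (μ := ρ) (f := fun a => f a - F k a) (C := ε)
      (ae_of_all _ fun a => by
        rw [← dist_eq_norm]
        exact ((ContinuousMap.dist_apply_le_dist (f := f.toContinuousMap) (g := F k) a)).trans
          hk.le)
    simpa using this
  rw [Metric.tendsto_nhds]
  intro ε hε
  obtain ⟨k, hk⟩ := hF.exists_dist_lt f.toContinuousMap (show 0 < ε / 4 by positivity)
  have hk' := (Metric.tendsto_nhds.1 (h k)) (ε / 4) (by positivity)
  filter_upwards [hk', eventually_gt_atTop 0] with t ht ht0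
  have h1 := abs_le.1 (hfF (μ t) (hμ t ht0) k _ hk)
  have h2 := abs_le.1 (hfF ν hν k _ hk)
  rw [Real.dist_eq, abs_lt] at ht ⊢
  constructor <;> linarith [ht.1, ht.2, h1.1, h1.2, h2.1, h2.2]

/-- The mean duration of a jump converges to `𝔼[e^{βC_0}]`; dividing by it turns the weighted
averages into integrals for the limit measure. -/
theorem convergesWeakly_of_path {p : unitInterval} {β : ℝ}
    (hint : Integrable (fun ω => Real.exp (β * clusterCard ω 0)) (percolation d p))
    {ω : Env d} {y : ℝ≥0 → ZLattice d} (hy : ∀ t, ∀ᶠ s in 𝓝[>] t, y s = y t)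
    (hfin : ∀ n, jumpTime y n < ⊤) {F : ℕ → C(Env d, ℝ)} (hF : DenseRange F)
    (h1 : Tendsto (fun n : ℕ => (∑ i ∈ Finset.range n, holdingTime y i) / n) atTop
      (𝓝 (∫ ω, Real.exp (β * clusterCard ω 0) ∂(percolation d p))))
    (h : ∀ k, Tendsto (fun n : ℕ => (∑ i ∈ Finset.range n, holdingTime y i
        * F k (shift (skeleton y i) ω)) / n) atTop
      (𝓝 (∫ ω, Real.exp (β * clusterCard ω 0) * F k ω ∂(percolation d p)))) :
    ConvergesWeakly (empiricalMeasure ω y) (limitMeasure d p β) := by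
  refine convergesWeakly_of_denseRange
    (fun t ht => isProbabilityMeasure_empiricalMeasure ω hy ht)
    (isProbabilityMeasure_limitMeasure hint) hF fun k => ?_
  rw [integral_limitMeasure hint]
  simp_rw [integral_empiricalMeasure ω hy _ _ (F k).continuous.measurable]
  have := tendsto_time_average hy hfin (g := fun x => F k (shift x ω)) (C := ‖F k‖)
    (fun x => (F k).norm_coe_le_norm _) (integral_exp_clusterCard_pos hint) h1 (h k)
  exact this.comp (NNReal.tendsto_coe_atTop.2 tendsto_id)

theorem sum_drivingSequence {β : ℝ} {ω : Env d} {y : ℝ≥0 → ZLattice d} (h0 : skeleton y 0 = 0)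
    (n : ℕ) : ∑ j ∈ Finset.range n, (drivingSequence β ω y j).1 = skeleton y n := by
  simp only [drivingSequence]
  rw [Finset.sum_range_sub, h0, sub_zero]

theorem exp_mul_drivingSequence_snd {β : ℝ} {ω : Env d} (y : ℝ≥0 → ZLattice d) (c : ℝ) (i : ℕ) :
    Real.exp (β * clusterCard ω (skeleton y i)) * c * (drivingSequence β ω y i).2
      = holdingTime y i * c := by
  rw [drivingSequence, jumpRate, Real.exp_neg]
  field_simp

end Environment

/-! ### Convergence for almost every environment -/

theorem corollary1 (d : ℕ) (hd : 1 ≤ d)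
    (p : unitInterval) (hp0 : 0 < (p : ℝ)) (hpc : (p : ℝ) < criticalParameter d)
    (l : EuclideanSpace ℝ (Fin d)) (hl : ‖l‖ = 1)
    (lam β : ℝ) (hlam : 0 ≤ lam) (hβ : 0 ≤ β) (hβξ : β < decayRate d p) :
    Integrable (fun ω => Real.exp (β * clusterCard ω 0)) (percolation d p) ∧
    ∀ᵐ ω ∂(percolation d p),
      ∀ (Ω' : Type*) [MeasurableSpace Ω'] (P : Measure Ω') (Y : ℝ≥0 → Ω' → ZLattice d),
        IsMarkovChainWithGenerator (walkGenerator l lam β ω) 0 Y P →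
        ∀ᵐ a ∂P, ConvergesWeakly (empiricalMeasure ω (Y · a)) (limitMeasure d p β) := by
  have hint := integrable_exp_clusterCard (d := d) hβ hβξ
  refine ⟨hint, ?_⟩
  have := isProbabilityMeasure_driveMeasure l lam hd
  have hF : DenseRange (TopologicalSpace.denseSeq C(Env d, ℝ)) :=
    TopologicalSpace.denseRange_denseSeq _
  set F := TopologicalSpace.denseSeq C(Env d, ℝ)
  have h1 := ae_tendsto_weighted_average (p := p) l lam hd hint (f := fun _ => 1)
    measurable_const (C := 1) (by simp)
  have hk := ae_all_iff.2 fun k => ae_tendsto_weighted_average (p := p) l lam hd hint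
    (F k).continuous.measurable (C := ‖F k‖) fun ω => (F k).norm_coe_le_norm _
  -- The exceptional environments are fixed before the chain and its probability space are
  -- introduced: they depend only on the universal law of the driving sequence, which `hmap` then
  -- transports to `P`.
  filter_upwards [h1, hk] with ω hω1 hωk
  intro Ω' _ P Y hY
  have hm := measurable_drivingSequence (β := β) (ω := ω) hY.measurable hY.right_continuous
  have hmap := hY.map_drivingSequence hd
  rw [← hmap] at hω1
  simp_rw [← hmap] at hωk
  filter_upwards [ae_of_ae_map hm.aemeasurable hω1,
    ae_all_iff.2 fun k => ae_of_ae_map hm.aemeasurable (hωk k), hY.ae_jumpTime_lt_top hd,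
    hY.ae_skeleton_zero] with a ha1 hak hfin h0
  simp only [sum_drivingSequence h0, exp_mul_drivingSequence_snd] at ha1 hak
  simp only [mul_one] at ha1
  exact convergesWeakly_of_path hint (hY.right_continuous a) (fun n => (hfin n).1) hF ha1 hak
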